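/- Let $\mathfrak g=\mathfrak g_{\bar 0}\oplus\mathfrak g_{\bar 1}$ be a finite-dimensional contragredient Lie superalgebra over $\mathbb C$ with Cartan subalgebra $\mathfrak h\subset\mathfrak g_{\bar 0}$. That is, $\mathfrak h$ is abelian and there are linearly independent $\alpha_1,\dots,\alpha_n\in\mathfrak h^*$, linearly independent $h_1,\dots,h_n\in\mathfrak h$ and homogeneous $e_i,f_i$ (with $e_i$ and $f_i$ of equal parity) such that $\mathfrak h,e_i,f_i$ generate $\mathfrak g$, $[a,e_i]=\alpha_i(a)e_i$, $[a,f_i]=-\alpha_i(a)f_i$ for $a\in\mathfrak h$, $[e_i,f_j]=\delta_{ij}h_i$, and no nonzero ideal of $\mathfrak g$ meets $\mathfrak h$ trivially. (This includes $\mathfrak{gl}(m|n)$.) Let $x\in\mathfrak g_{\bar 1}$ be nonzero with $[x,x]=0$. Put $\mathfrak g^x=\{a\in\mathfrak g\mid [x,a]=0\}$ and $\mathfrak g_x=\mathfrak g^x/[x,\mathfrak g]$, and for a finite-dimensional $\mathfrak g$-module $M$ put $DS_x(M)=M_x=\ker_M x/xM$, which is a $\mathfrak g_x$-module. For a Lie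 superalgebra $\mathfrak a$, let $\mathcal K_{\mathfrak a}$ be the quotient of the Grothendieck ring of the category of finite-dimensional $\mathfrak a$-modules (with product given by $\otimes$) by the ideal generated by all $[\Pi M]+[M]$, where $\Pi$ is the parity shift. For a Cartan subalgebra $\mathfrak t$ of $\mathfrak a_{\bar 0}$, let $$\operatorname{sch}_{\mathfrak t}M=\sum_{\mu\in\mathfrak t^*}(\dim M^\mu_{\bar 0}-\dim M^\mu_{\bar 1})\,e^\mu\in\mathbb Z[\mathfrak t^*],$$ where $M^\mu$ are the (generalized) weight spaces, and let $\mathcal J_{\mathfrak a}=\mathcal J_{\mathfrak a,\mathfrak t}\subset\mathbb Z[\mathfrak t^*]$ be the supercharacter ring, i.e. the subring generated by all supercharacters. Then: 1. There is a unique ring homomorphism $ds_x:\mathcal K_{\mathfrak g}\to\mathcal K_{\mathfrak g_x}$ with $ds_x([M])=[M_x]$ for every finite-dimensional $\mathfrak g$-module $M$. 2. For every Cartan subalgebra $\mathfrak t$ of $(\mathfrak g_x)_{\bar 0}$, the rings $\mathcal J_{\mathfrak g}=\mathcal J_{\mathfrak g,\mathfrak h}$ and $\mathcal J_{\mathfrak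 g_x}=\mathcal J_{\mathfrak g_x,\mathfrak t}$ consist exactly of the supercharacters of finite-dimensional modules, and there is a unique ring homomorphism $ds_x:\mathcal J_{\mathfrak g}\to\mathcal J_{\mathfrak g_x}$ with $ds_x(\operatorname{sch}_{\mathfrak h}M)=\operatorname{sch}_{\mathfrak t}M_x$ for every finite-dimensional $\mathfrak g$-module $M$. 3. If moreover $\mathfrak t=\mathfrak h_x$ is embedded in $\mathfrak h$, i.e. $\iota:\mathfrak t\to\mathfrak h$ is linear, and for all $a\in\mathfrak t$ one has $\iota(a)\in\mathfrak g^x$ and the class of $\iota(a)$ in $\mathfrak g_x$ is $a$, then $\operatorname{sch}_{\mathfrak t}M_x$ is the restriction of $\operatorname{sch}_{\mathfrak h}M$ along $\iota$ (that is, $e^\mu\mapsto e^{\mu\circ\iota}$). -/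

import Mathlib

universe u v

noncomputable section

namespace Super

/-- The sign `(-1)^i` for `i ∈ ℤ/2`. -/
def sgn (i : ZMod 2) : ℂ := if i = 0 then 1 else -1

/-- A `ℤ/2`-grading `V = V_0 ⊕ V_1` of a complex vector space is given by its parity
involution `θ`, which acts by `(-1)^i` on `V_i`; `homog θ i` is the component `V_i`. -/
def homog {V : Type*} [AddCommGroup V] [Module ℂ V] (θ : V →ₗ[ℂ] V) (i : ZMod 2) :
    Submodule ℂ V :=
  LinearMap.ker (θ - sgn i • LinearMap.id)

section Grading

theorem zmod_two_cases (i : ZMod 2) : i = 0 ∨ i = 1 := by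
  revert i; decide

@[simp] theorem sgn_zero : sgn 0 = 1 := by simp [sgn]

@[simp] theorem sgn_one : sgn 1 = -1 := by simp [sgn]

theorem sgn_add (i j : ZMod 2) : sgn (i + j) = sgn i * sgn j := by
  have h2 : (1 : ZMod 2) + 1 = 0 := by decide
  rcases zmod_two_cases i with rfl | rfl <;> rcases zmod_two_cases j with rfl | rfl <;>
    simp [h2]

theorem sgn_sq (i : ZMod 2) : sgn i * sgn i = 1 := by
  rcases zmod_two_cases i with rfl | rfl <;> simp

variable {V : Type*} [AddCommGroup V] [Module ℂ V]

theorem mem_homog {θ : V →ₗ[ℂ] V} {i : ZMod 2} {v : V} :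
    v ∈ homog θ i ↔ θ v = sgn i • v := by
  simp [homog, sub_eq_zero]

/-- The projection of `V` onto the component `V_i`. -/
def proj (θ : V →ₗ[ℂ] V) (i : ZMod 2) : V →ₗ[ℂ] V :=
  (1 / 2 : ℂ) • (LinearMap.id + sgn i • θ)

theorem proj_apply (θ : V →ₗ[ℂ] V) (i : ZMod 2) (v : V) :
    proj θ i v = (1 / 2 : ℂ) • (v + sgn i • θ v) := rfl

theorem proj_mem {θ : V →ₗ[ℂ] V} (hθ : ∀ v, θ (θ v) = v) (i : ZMod 2) (v : V) :
    proj θ i v ∈ homog θ i := by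
  rw [mem_homog, proj_apply]
  simp only [map_smul, map_add, hθ, smul_add, smul_smul]
  rw [show sgn i * (1 / 2 * sgn i) = 1 / 2 by linear_combination (1 / 2) * sgn_sq i]
  rw [add_comm, mul_comm (sgn i)]

theorem proj_add (θ : V →ₗ[ℂ] V) (v : V) : proj θ 0 v + proj θ 1 v = v := by
  simp only [proj_apply, sgn_zero, sgn_one]
  module

theorem proj_of_mem {θ : V →ₗ[ℂ] V} {i : ZMod 2} {v : V} (h : v ∈ homog θ i) (j : ZMod 2) :
    proj θ j v = if i = j then v else 0 := by
  rw [mem_homog] at h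
  rw [proj_apply, h]
  rcases zmod_two_cases i with rfl | rfl <;> rcases zmod_two_cases j with rfl | rfl <;>
    simp <;> module

theorem homog_induction {θ : V →ₗ[ℂ] V} (hθ : ∀ v, θ (θ v) = v) {p : V → Prop}
    (hom : ∀ i, ∀ v ∈ homog θ i, p v) (add : ∀ v w, p v → p w → p (v + w)) (v : V) : p v := by
  rw [← proj_add θ v]
  exact add _ _ (hom 0 _ (proj_mem hθ 0 v)) (hom 1 _ (proj_mem hθ 1 v))

/-- An involution really is a grading: `V = V_0 ⊕ V_1`. -/
theorem isCompl_homog {θ : V →ₗ[ℂ] V} (hθ : ∀ v, θ (θ v) = v) :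
    IsCompl (homog θ 0) (homog θ 1) := by
  constructor
  · rw [Submodule.disjoint_def]
    intro v h0 h1
    have := proj_of_mem h0 0
    rw [proj_of_mem h1 0] at this
    simpa using this.symm
  · rw [codisjoint_iff_le_sup]
    intro v _
    rw [← proj_add θ v]
    exact Submodule.add_mem_sup (proj_mem hθ 0 v) (proj_mem hθ 1 v)

end Grading

/-- A complex Lie superalgebra: a `ℤ/2`-graded vector space `g` (graded by the involution `par`)
with an even bilinear bracket that is super-skew-symmetric and satisfies the super Jacobi
identity. -/
class LieSuperalgebra (g : Type u) [AddCommGroup g] [Module ℂ g] where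
  par : g →ₗ[ℂ] g
  par_par : ∀ a, par (par a) = a
  br : g →ₗ[ℂ] g →ₗ[ℂ] g
  br_mem : ∀ {i j : ZMod 2} {a b : g}, a ∈ homog par i → b ∈ homog par j →
    br a b ∈ homog par (i + j)
  br_skew : ∀ {i j : ZMod 2} {a b : g}, a ∈ homog par i → b ∈ homog par j →
    br a b = -(sgn (i * j) • br b a)
  br_jacobi : ∀ {i j k : ZMod 2} {a b c : g},
    a ∈ homog par i → b ∈ homog par j → c ∈ homog par k →
    br a (br b c) = br (br a b) c + sgn (i * j) • br b (br a c)

/-- The homogeneous component `g_i` of a Lie superalgebra. -/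
abbrev part (g : Type u) [AddCommGroup g] [Module ℂ g] [LieSuperalgebra g] (i : ZMod 2) :
    Submodule ℂ g :=
  homog (LieSuperalgebra.par (g := g)) i

open LieSuperalgebra

section EvenPart

variable (g : Type u) [AddCommGroup g] [Module ℂ g] [LieSuperalgebra g]

variable {g} in
theorem br_even_mem {a b : g} (ha : a ∈ part g 0) (hb : b ∈ part g 0) : br a b ∈ part g 0 := by
  simpa using br_mem ha hb

variable {g} in
theorem br_even_skew {a b : g} (ha : a ∈ part g 0) (hb : b ∈ part g 0) :
    br a b = -br b a := by
  simpa using br_skew ha hb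

/-- The even part `g_0` is an ordinary Lie algebra. -/
instance evenLieRing : LieRing (part g 0) where
  bracket a b := ⟨br (a : g) (b : g), br_even_mem a.2 b.2⟩
  add_lie a b c := Subtype.ext (by simp)
  lie_add a b c := Subtype.ext (by simp)
  lie_self a := Subtype.ext (by
    have h := br_even_skew a.2 a.2
    have h2 : (2 : ℂ) • br (a : g) (a : g) = 0 := by
      rw [two_smul]; exact eq_neg_iff_add_eq_zero.mp h
    simpa using h2)
  leibniz_lie a b c := Subtype.ext (by simpa using br_jacobi a.2 b.2 c.2)

instance evenLieAlgebra : LieAlgebra ℂ (part g 0) where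
  lie_smul t a b := Subtype.ext (by
    change br (a : g) ((t • b : part g 0) : g) = t • br (a : g) (b : g)
    simp)

end EvenPart

/-- A representation of a Lie superalgebra `g` on a vector space `V`: a `ℤ/2`-grading of `V`
(with parity involution `par`) and a compatible action of `g` with
`[a,b] v = a (b v) - (-1)^{|a||b|} b (a v)` for homogeneous `a`, `b`. -/
structure SuperRep (g : Type u) [AddCommGroup g] [Module ℂ g] [LieSuperalgebra g]
    (V : Type v) [AddCommGroup V] [Module ℂ V] where
  par : V →ₗ[ℂ] V
  par_par : ∀ m, par (par m) = m
  act : g →ₗ[ℂ] Module.End ℂ V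
  act_mem : ∀ {i j : ZMod 2} {a : g} {m : V}, a ∈ part g i → m ∈ homog par j →
    act a m ∈ homog par (i + j)
  act_br : ∀ {i j : ZMod 2} {a b : g}, a ∈ part g i → b ∈ part g j → ∀ m : V,
    act (br a b) m = act a (act b m) - sgn (i * j) • act b (act a m)

namespace SuperRep

variable {g : Type u} [AddCommGroup g] [Module ℂ g] [LieSuperalgebra g]
variable {V : Type v} [AddCommGroup V] [Module ℂ V]

theorem par_act (R : SuperRep g V) (a : g) (m : V) :
    R.par (R.act a m) = R.act (LieSuperalgebra.par a) (R.par m) := by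
  induction a using homog_induction (LieSuperalgebra.par_par (g := g)) with
  | add a b ha hb => simp [ha, hb]
  | hom i a ha =>
    induction m using homog_induction R.par_par with
    | add m n hm hn => simp [hm, hn]
    | hom j m hm =>
      have h := mem_homog.mp (R.act_mem ha hm)
      rw [h, mem_homog.mp ha, mem_homog.mp hm, sgn_add]
      simp [smul_smul, mul_comm]

/-- A representation from an even action. -/
def mk' (par : V →ₗ[ℂ] V) (par_par : ∀ m, par (par m) = m) (act : g →ₗ[ℂ] Module.End ℂ V)
    (par_act : ∀ a m, par (act a m) = act (LieSuperalgebra.par a) (par m))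
    (act_br : ∀ {i j : ZMod 2} {a b : g}, a ∈ part g i → b ∈ part g j → ∀ m : V,
      act (br a b) m = act a (act b m) - sgn (i * j) • act b (act a m)) : SuperRep g V where
  par := par
  par_par := par_par
  act := act
  act_mem {i j a m} ha hm := by
    rw [mem_homog, par_act, mem_homog.mp ha, mem_homog.mp hm, sgn_add]
    simp [smul_smul, mul_comm]
  act_br := act_br

variable (g) in
/-- The adjoint representation. -/
def adjoint : SuperRep g g where
  par := LieSuperalgebra.par
  par_par := LieSuperalgebra.par_par
  act := br
  act_mem ha hm := br_mem ha hm
  act_br {i j a b} ha hb m := by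
    induction m using homog_induction (LieSuperalgebra.par_par (g := g)) with
    | add m n hm hn => simp only [map_add, smul_add, hm, hn]; abel
    | hom k m hm => rw [br_jacobi ha hb hm]; abel

/-- The restriction of a representation to the Lie algebra `g_0`. -/
abbrev evenLieRingModule (R : SuperRep g V) : LieRingModule (part g 0) V where
  bracket a m := R.act (a : g) m
  add_lie a b m := by simp
  lie_add a m n := by simp
  leibniz_lie a b m := by
    change R.act a (R.act b m) = R.act (br (a : g) (b : g)) m + R.act b (R.act a m)
    rw [R.act_br a.2 b.2]; simp

end SuperRep

/-- The set `X_g` of odd elements `x` with `[x,x] = 0`. -/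
structure SelfCommuting (g : Type u) [AddCommGroup g] [Module ℂ g] [LieSuperalgebra g] where
  elt : g
  odd : elt ∈ part g 1
  sq : br elt elt = 0

namespace SuperRep

variable {g : Type u} [AddCommGroup g] [Module ℂ g] [LieSuperalgebra g]
variable {V : Type v} [AddCommGroup V] [Module ℂ V]

/-- The cohomology `V_x = ker x / x V`. -/
def Coh (R : SuperRep g V) (x : SelfCommuting g) : Type v :=
  LinearMap.ker (R.act x.elt) ⧸ (LinearMap.range (R.act x.elt)).submoduleOf (LinearMap.ker (R.act x.elt))

section

variable (R : SuperRep g V) (x : SelfCommuting g)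

instance : AddCommGroup (R.Coh x) := Submodule.Quotient.addCommGroup _

instance : Module ℂ (R.Coh x) := Submodule.Quotient.module _

instance [FiniteDimensional ℂ V] : FiniteDimensional ℂ (R.Coh x) :=
  Module.Finite.quotient ℂ _

/-- The class in `V_x` of an element of `ker x`. -/
def cls : LinearMap.ker (R.act x.elt) →ₗ[ℂ] R.Coh x := Submodule.mkQ _

theorem cls_surjective : Function.Surjective (R.cls x) := Submodule.mkQ_surjective _

theorem cls_eq_zero {m : LinearMap.ker (R.act x.elt)} :
    R.cls x m = 0 ↔ ∃ n, R.act x.elt n = (m : V) := by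
  exact (Submodule.Quotient.mk_eq_zero _).trans Iff.rfl

theorem par_x (m : V) : R.par (R.act x.elt m) = -R.act x.elt (R.par m) := by
  rw [R.par_act, mem_homog.mp x.odd]; simp

theorem act_br_x (a : g) (m : V) :
    R.act (br x.elt a) m = R.act x.elt (R.act a m) - R.act (LieSuperalgebra.par a) (R.act x.elt m) := by
  induction a using homog_induction (LieSuperalgebra.par_par (g := g)) with
  | add a b ha hb => simp only [map_add, LinearMap.add_apply, ha, hb]; abel
  | hom i a ha => rw [R.act_br x.odd ha, mem_homog.mp ha]; simp

theorem par_centralizer {a : g} (ha : br x.elt a = 0) : br x.elt (LieSuperalgebra.par a) = 0 := by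
  have h := (adjoint g).par_x x a
  change LieSuperalgebra.par (br x.elt a) = -br x.elt (LieSuperalgebra.par a) at h
  rw [ha, map_zero] at h
  exact neg_eq_zero.mp h.symm

theorem act_mem_ker {a : g} (ha : br x.elt a = 0) {m : V} (hm : R.act x.elt m = 0) :
    R.act x.elt (R.act a m) = 0 := by
  have h := R.act_br_x x a m
  rw [ha, hm] at h
  simpa using h.symm

theorem act_x_comm {a : g} (ha : br x.elt a = 0) (m : V) :
    R.act a (R.act x.elt m) = R.act x.elt (R.act (LieSuperalgebra.par a) m) := by
  have h := R.act_br_x x (LieSuperalgebra.par a) m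
  rw [par_centralizer x ha, LieSuperalgebra.par_par] at h
  simpa using (sub_eq_zero.mp (by simpa using h.symm)).symm

/-- The grading of `V_x`. -/
def cohPar : R.Coh x →ₗ[ℂ] R.Coh x :=
  Submodule.mapQ _ _
    (R.par.restrict (p := LinearMap.ker (R.act x.elt)) (q := LinearMap.ker (R.act x.elt))
      (fun m hm => by
        have h := R.par_x x m
        rw [LinearMap.mem_ker] at hm ⊢
        rw [hm, map_zero] at h
        exact neg_eq_zero.mp h.symm))
    (by
      rintro ⟨m, hm⟩ ⟨n, hn⟩
      refine ⟨-R.par n, ?_⟩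
      change R.act x.elt n = m at hn
      change R.act x.elt (-R.par n) = R.par m
      rw [← hn, R.par_x, map_neg])

/-- The endomorphism of `V_x` induced by an element of the centralizer `g^x`. -/
def cohEnd (a : LinearMap.ker ((adjoint g).act x.elt)) : Module.End ℂ (R.Coh x) :=
  Submodule.mapQ _ _
    ((R.act (a : g)).restrict (p := LinearMap.ker (R.act x.elt)) (q := LinearMap.ker (R.act x.elt))
      (fun _ hm => R.act_mem_ker x a.2 hm))
    (by
      rintro ⟨m, hm⟩ ⟨n, hn⟩
      refine ⟨R.act (LieSuperalgebra.par (a : g)) n, ?_⟩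
      change R.act x.elt n = m at hn
      change R.act x.elt _ = R.act (a : g) m
      rw [← hn, R.act_x_comm x a.2])

theorem cohEnd_cls (a : LinearMap.ker ((adjoint g).act x.elt)) (m : LinearMap.ker (R.act x.elt)) :
    R.cohEnd x a (R.cls x m) = R.cls x ⟨R.act (a : g) m, R.act_mem_ker x a.2 m.2⟩ := rfl

theorem cohPar_cls (m : LinearMap.ker (R.act x.elt)) (h : R.act x.elt (R.par m) = 0) :
    R.cohPar x (R.cls x m) = R.cls x ⟨R.par m, h⟩ := rfl

/-- The action of `g_x = g^x / [x,g]` on `V_x`, induced by the action of `g^x` on `ker x`. -/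
def cohAct : (adjoint g).Coh x →ₗ[ℂ] Module.End ℂ (R.Coh x) :=
  Submodule.liftQ _
    { toFun := R.cohEnd x
      map_add' := fun a b => by
        ext m
        obtain ⟨m, rfl⟩ := R.cls_surjective x m
        simp only [LinearMap.add_apply, cohEnd_cls, ← map_add]
        congr 1
        ext
        simp
      map_smul' := fun t a => by
        ext m
        obtain ⟨m, rfl⟩ := R.cls_surjective x m
        simp only [LinearMap.smul_apply, cohEnd_cls, ← map_smul, RingHom.id_apply]
        congr 1
        ext
        simp }
    (by
      rintro ⟨a, ha⟩ ⟨b, hb⟩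
      change br x.elt b = a at hb
      rw [LinearMap.mem_ker]
      ext m
      obtain ⟨m, rfl⟩ := R.cls_surjective x m
      change R.cohEnd x _ (R.cls x m) = 0
      rw [cohEnd_cls, cls_eq_zero]
      refine ⟨R.act b m, ?_⟩
      have h := R.act_br_x x b m
      rw [LinearMap.mem_ker.mp m.2, map_zero, sub_zero] at h
      change _ = R.act a m
      rw [← h, hb])

theorem cohAct_cls (a : LinearMap.ker ((adjoint g).act x.elt)) (m : LinearMap.ker (R.act x.elt)) :
    R.cohAct x ((adjoint g).cls x a) (R.cls x m) =
      R.cls x ⟨R.act (a : g) m, R.act_mem_ker x a.2 m.2⟩ := rfl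

theorem par_mem_ker {m : V} (hm : R.act x.elt m = 0) : R.act x.elt (R.par m) = 0 := by
  have h := R.par_x x m
  rw [hm, map_zero] at h
  exact neg_eq_zero.mp h.symm

theorem cohPar_cohPar (m : R.Coh x) : R.cohPar x (R.cohPar x m) = m := by
  obtain ⟨m, rfl⟩ := R.cls_surjective x m
  rw [cohPar_cls _ _ _ (R.par_mem_ker x m.2),
    cohPar_cls _ _ _ (R.par_mem_ker x (R.par_mem_ker x m.2))]
  congr 1
  ext
  exact R.par_par m

theorem cohPar_cohAct (a : (adjoint g).Coh x) (m : R.Coh x) :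
    R.cohPar x (R.cohAct x a m) = R.cohAct x ((adjoint g).cohPar x a) (R.cohPar x m) := by
  obtain ⟨m, rfl⟩ := R.cls_surjective x m
  obtain ⟨a, rfl⟩ := (adjoint g).cls_surjective x a
  rw [cohAct_cls, cohPar_cls _ _ _ (R.par_mem_ker x (R.act_mem_ker x a.2 m.2)),
    cohPar_cls _ _ _ (R.par_mem_ker x m.2), cohPar_cls _ _ _ ((adjoint g).par_mem_ker x a.2),
    cohAct_cls]
  congr 1
  ext
  exact R.par_act a m

/-- Homogeneous classes have homogeneous representatives. -/
theorem exists_homog_rep {i : ZMod 2} {m : R.Coh x} (hm : m ∈ homog (R.cohPar x) i) :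
    ∃ n : LinearMap.ker (R.act x.elt), (n : V) ∈ homog R.par i ∧ R.cls x n = m := by
  obtain ⟨n, rfl⟩ := R.cls_surjective x m
  have hp : R.act x.elt (proj R.par i n) = 0 := by
    rw [proj_apply]
    simp [LinearMap.mem_ker.mp n.2, R.par_mem_ker x n.2]
  refine ⟨⟨proj R.par i n, hp⟩, proj_mem R.par_par i _, ?_⟩
  have h : R.cls x ⟨proj R.par i n, hp⟩ = proj (R.cohPar x) i (R.cls x n) := by
    rw [proj_apply (R.cohPar x), cohPar_cls _ _ _ (R.par_mem_ker x n.2), ← map_smul, ← map_add, ← map_smul]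
    rfl
  rw [h, proj_of_mem hm]
  simp

theorem cohAct_br {i j : ZMod 2} {a b : (adjoint g).Coh x}
    (ha : a ∈ homog ((adjoint g).cohPar x) i) (hb : b ∈ homog ((adjoint g).cohPar x) j)
    (m : R.Coh x) :
    R.cohAct x ((adjoint g).cohAct x a b) m =
      R.cohAct x a (R.cohAct x b m) - sgn (i * j) • R.cohAct x b (R.cohAct x a m) := by
  obtain ⟨m, rfl⟩ := R.cls_surjective x m
  obtain ⟨a, ha', rfl⟩ := (adjoint g).exists_homog_rep x ha
  obtain ⟨b, hb', rfl⟩ := (adjoint g).exists_homog_rep x hb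
  simp only [cohAct_cls, ← map_smul, ← map_sub]
  congr 1
  ext
  exact R.act_br ha' hb' m

end

end SuperRep

/-- The Lie superalgebra `g_x = g^x / [x,g]`, where `g^x` is the centralizer of `x` in `g`. -/
abbrev DSAlg {g : Type u} [AddCommGroup g] [Module ℂ g] [LieSuperalgebra g]
    (x : SelfCommuting g) : Type u :=
  (SuperRep.adjoint g).Coh x

section

variable {g : Type u} [AddCommGroup g] [Module ℂ g] [LieSuperalgebra g]

/-- The bracket of `g_x` is induced by the bracket of `g`. -/
instance (x : SelfCommuting g) : LieSuperalgebra (DSAlg x) where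
  par := (SuperRep.adjoint g).cohPar x
  par_par := (SuperRep.adjoint g).cohPar_cohPar x
  br := (SuperRep.adjoint g).cohAct x
  br_mem {i j a b} ha hb := by
    rw [mem_homog, SuperRep.cohPar_cohAct, mem_homog.mp ha, mem_homog.mp hb, sgn_add]
    simp [smul_smul, mul_comm]
  br_skew {i j a b} ha hb := by
    obtain ⟨a, ha', rfl⟩ := (SuperRep.adjoint g).exists_homog_rep x ha
    obtain ⟨b, hb', rfl⟩ := (SuperRep.adjoint g).exists_homog_rep x hb
    simp only [SuperRep.cohAct_cls, ← map_smul, ← map_neg]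
    congr 1
    ext
    exact br_skew ha' hb'
  br_jacobi {i j k a b c} ha hb _ := by
    rw [(SuperRep.adjoint g).cohAct_br x ha hb c]; abel

/-- `V_x` is a representation of `g_x`. -/
def SuperRep.ds {V : Type v} [AddCommGroup V] [Module ℂ V] (R : SuperRep g V)
    (x : SelfCommuting g) : SuperRep (DSAlg x) (R.Coh x) :=
  .mk' (R.cohPar x) (R.cohPar_cohPar x) (R.cohAct x) (R.cohPar_cohAct x)
    (fun ha hb m => R.cohAct_br x ha hb m)

end

open TensorProduct

theorem sgn_mul_add (i j k : ZMod 2) : sgn (i * (j + k)) = sgn (i * j) * sgn (i * k) := by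
  rw [mul_add, sgn_add]

theorem sgn_add_mul (i j k : ZMod 2) : sgn ((i + j) * k) = sgn (i * k) * sgn (j * k) := by
  rw [add_mul, sgn_add]

namespace SuperRep

variable {g : Type u} [AddCommGroup g] [Module ℂ g] [LieSuperalgebra g]
variable {V W : Type v} [AddCommGroup V] [Module ℂ V] [AddCommGroup W] [Module ℂ W]

/-- The action of `g` on a tensor product:
`a (m ⊗ n) = a m ⊗ n + (-1)^{|a||m|} m ⊗ a n`. -/
def tensorAct (R : SuperRep g V) (S : SuperRep g W) : g →ₗ[ℂ] Module.End ℂ (V ⊗[ℂ] W) where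
  toFun a := map (R.act a) LinearMap.id +
    map LinearMap.id (S.act (proj LieSuperalgebra.par 0 a)) +
    map R.par (S.act (proj LieSuperalgebra.par 1 a))
  map_add' a b := by
    ext m n
    simp [TensorProduct.add_tmul, TensorProduct.tmul_add]
    abel
  map_smul' t a := by
    ext m n
    simp [TensorProduct.smul_tmul']

theorem tensorAct_tmul (R : SuperRep g V) (S : SuperRep g W) {i k : ZMod 2} {a : g} {m : V}
    (ha : a ∈ part g i) (hm : m ∈ homog R.par k) (n : W) :
    tensorAct R S a (m ⊗ₜ n) = R.act a m ⊗ₜ n + sgn (i * k) • (m ⊗ₜ S.act a n) := by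
  simp only [tensorAct, LinearMap.coe_mk, AddHom.coe_mk, LinearMap.add_apply, map_tmul,
    LinearMap.id_coe, id_eq, proj_of_mem ha, mem_homog.mp hm]
  rcases zmod_two_cases i with rfl | rfl <;> simp [TensorProduct.smul_tmul']

/-- To compare linear maps on `V ⊗ W`, it suffices to look at `m ⊗ n` with `m`, `n` homogeneous. -/
theorem tensor_induction {θ : V →ₗ[ℂ] V} {η : W →ₗ[ℂ] W} (hθ : ∀ v, θ (θ v) = v)
    (hη : ∀ v, η (η v) = v) {p : V ⊗[ℂ] W → Prop} (zero : p 0)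
    (tmul : ∀ i j, ∀ m ∈ homog θ i, ∀ n ∈ homog η j, p (m ⊗ₜ n))
    (add : ∀ s t, p s → p t → p (s + t)) (t : V ⊗[ℂ] W) : p t := by
  induction t using TensorProduct.induction_on with
  | zero => exact zero
  | add s t hs ht => exact add s t hs ht
  | tmul m n =>
    induction m using homog_induction hθ with
    | add m m' hm hm' => rw [TensorProduct.add_tmul]; exact add _ _ hm hm'
    | hom i m hm =>
      induction n using homog_induction hη with
      | add n n' hn hn' => rw [TensorProduct.tmul_add]; exact add _ _ hn hn'
      | hom j n hn => exact tmul i j m hm n hn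

theorem tmul_mem {R : SuperRep g V} {S : SuperRep g W} {i j : ZMod 2} {m : V} {n : W}
    (hm : m ∈ homog R.par i) (hn : n ∈ homog S.par j) :
    m ⊗ₜ n ∈ homog (map R.par S.par) (i + j) := by
  rw [mem_homog, map_tmul, mem_homog.mp hm, mem_homog.mp hn, sgn_add]
  simp [TensorProduct.smul_tmul', smul_smul, mul_comm]

/-- The tensor product of two representations. -/
def tensor (R : SuperRep g V) (S : SuperRep g W) : SuperRep g (V ⊗[ℂ] W) where
  par := map R.par S.par
  par_par t := by
    induction t using TensorProduct.induction_on with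
    | zero => simp
    | add s t hs ht => simp only [map_add, hs, ht]
    | tmul m n => simp [R.par_par, S.par_par]
  act := tensorAct R S
  act_mem {i j a t} ha ht := by
    have key : ∀ t, map R.par S.par (tensorAct R S a t) =
        sgn i • tensorAct R S a (map R.par S.par t) := by
      intro t
      induction t using tensor_induction R.par_par S.par_par with
      | zero => simp
      | add s t hs ht => simp only [map_add, hs, ht, smul_add]
      | tmul k l m hm n hn =>
        rw [mem_homog.mp (tmul_mem hm hn), map_smul, tensorAct_tmul R S ha hm, map_add, map_smul,
          mem_homog.mp (tmul_mem (R.act_mem ha hm) hn),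
          mem_homog.mp (tmul_mem hm (S.act_mem ha hn))]
        simp only [sgn_add]
        module
    rw [mem_homog, key, mem_homog.mp ht, map_smul, smul_smul, sgn_add]
  act_br {i j a b} ha hb t := by
    induction t using tensor_induction R.par_par S.par_par with
    | zero => simp
    | add s t hs ht => simp only [map_add, hs, ht, smul_add]; abel
    | tmul k l m hm n hn =>
      rw [tensorAct_tmul R S (br_mem ha hb) hm, tensorAct_tmul R S ha hm,
        tensorAct_tmul R S hb hm, map_add, map_add, map_smul, map_smul,
        tensorAct_tmul R S ha (R.act_mem hb hm), tensorAct_tmul R S ha hm,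
        tensorAct_tmul R S hb (R.act_mem ha hm), tensorAct_tmul R S hb hm,
        R.act_br ha hb, S.act_br ha hb, TensorProduct.sub_tmul, TensorProduct.tmul_sub,
        ← TensorProduct.smul_tmul', TensorProduct.tmul_smul]
      simp only [sgn_add_mul, sgn_mul_add, mul_comm j i]
      have h2 := sgn_sq (i * j)
      generalize sgn (i * j) = s at *
      rcases mul_self_eq_one_iff.mp h2 with rfl | rfl <;> module

variable (g) in
/-- The trivial representation on the even line. -/
def trivial : SuperRep g (ULift.{v} ℂ) where
  par := LinearMap.id
  par_par _ := rfl
  act := 0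
  act_mem _ _ := by simp
  act_br _ _ _ := by simp

/-- The parity shift `Π`. -/
def shift (R : SuperRep g V) : SuperRep g V where
  par := -R.par
  par_par m := by simp [R.par_par]
  act := R.act
  act_mem {i j a m} ha hm := by
    rw [mem_homog] at hm ⊢
    rw [LinearMap.neg_apply, neg_eq_iff_eq_neg] at hm ⊢
    rw [R.par_act, mem_homog.mp ha, hm, sgn_add]
    simp [smul_smul]
  act_br ha hb m := R.act_br ha hb m

/-- Homomorphisms of representations: parity preserving linear maps that commute with `g`. -/
structure IsHom (R : SuperRep g V) (S : SuperRep g W) (f : V →ₗ[ℂ] W) : Prop where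
  map_par : ∀ m, f (R.par m) = S.par (f m)
  map_act : ∀ a m, f (R.act a m) = S.act a (f m)

/-- It suffices to check compatibility with the action on homogeneous elements of `g`. -/
theorem IsHom.of_homog {R : SuperRep g V} {S : SuperRep g W} {f : V →ₗ[ℂ] W}
    (hp : ∀ m, f (R.par m) = S.par (f m))
    (ha : ∀ i, ∀ a ∈ part g i, ∀ m, f (R.act a m) = S.act a (f m)) : IsHom R S f := by
  refine ⟨hp, fun a => ?_⟩
  induction a using homog_induction (LieSuperalgebra.par_par (g := g)) with
  | hom i a h => exact ha i a h
  | add a b ha hb => intro m; simp [ha, hb]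

theorem IsHom.tensor {V' W' : Type v} [AddCommGroup V'] [Module ℂ V'] [AddCommGroup W']
    [Module ℂ W'] {R : SuperRep g V} {S : SuperRep g W} {R' : SuperRep g V'} {S' : SuperRep g W'}
    {e : V →ₗ[ℂ] V'} {f : W →ₗ[ℂ] W'} (he : IsHom R R' e) (hf : IsHom S S' f) :
    IsHom (R.tensor S) (R'.tensor S') (map e f) := by
  refine .of_homog (fun t => ?_) (fun i a ha t => ?_)
  · change map e f (map R.par S.par t) = map R'.par S'.par (map e f t)
    induction t using TensorProduct.induction_on with
    | zero => simp
    | add s t hs ht => simp only [map_add, hs, ht]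
    | tmul m n => simp [he.map_par, hf.map_par]
  · change map e f (tensorAct R S a t) = tensorAct R' S' a (map e f t)
    induction t using tensor_induction R.par_par S.par_par with
    | zero => simp
    | add s t hs ht => simp only [map_add, hs, ht]
    | tmul k l m hm n hn =>
      have hm' : e m ∈ homog R'.par k := by
        rw [mem_homog, ← he.map_par, mem_homog.mp hm, map_smul]
      rw [tensorAct_tmul _ _ ha hm, map_tmul, tensorAct_tmul _ _ ha hm']
      simp [he.map_act, hf.map_act]

theorem isHom_assoc {X : Type v} [AddCommGroup X] [Module ℂ X] (R : SuperRep g V)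
    (S : SuperRep g W) (T : SuperRep g X) :
    IsHom ((R.tensor S).tensor T) (R.tensor (S.tensor T))
      (TensorProduct.assoc ℂ V W X : _ →ₗ[ℂ] _) := by
  refine .of_homog (fun t => ?_) (fun i a ha t => ?_)
  · change TensorProduct.assoc ℂ V W X (map (map R.par S.par) T.par t) =
      map R.par (map S.par T.par) (TensorProduct.assoc ℂ V W X t)
    induction t using TensorProduct.induction_on with
    | zero => simp
    | add s t hs ht => simp only [map_add, hs, ht]
    | tmul s p =>
      induction s using TensorProduct.induction_on with
      | zero => simp
      | add s t hs ht => simp only [TensorProduct.add_tmul, map_add, hs, ht]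
      | tmul m n => simp
  · change TensorProduct.assoc ℂ V W X (tensorAct (R.tensor S) T a t) =
      tensorAct R (S.tensor T) a (TensorProduct.assoc ℂ V W X t)
    induction t using TensorProduct.induction_on with
    | zero => simp
    | add s t hs ht => simp only [map_add, hs, ht]
    | tmul s p =>
      induction s using tensor_induction R.par_par S.par_par with
      | zero => simp
      | add s t hs ht => simp only [TensorProduct.add_tmul, map_add, hs, ht]
      | tmul k l m hm n hn =>
        rw [tensorAct_tmul (R.tensor S) T ha (tmul_mem hm hn) p,
          TensorProduct.assoc_tmul, tensorAct_tmul R (S.tensor T) ha hm]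
        change TensorProduct.assoc ℂ V W X ((tensorAct R S a (m ⊗ₜ n)) ⊗ₜ p + _) =
          _ + _ • m ⊗ₜ (tensorAct S T a (n ⊗ₜ p))
        rw [tensorAct_tmul _ _ ha hm, tensorAct_tmul _ _ ha hn, sgn_mul_add]
        simp only [TensorProduct.add_tmul, map_add, ← TensorProduct.smul_tmul', map_smul,
          TensorProduct.assoc_tmul, TensorProduct.tmul_add, TensorProduct.tmul_smul]
        module

/-- The supersymmetric flip `m ⊗ n ↦ (-1)^{|m||n|} n ⊗ m`. -/
def flip (R : SuperRep g V) (S : SuperRep g W) : V ⊗[ℂ] W →ₗ[ℂ] W ⊗[ℂ] V :=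
  (TensorProduct.comm ℂ V W : _ →ₗ[ℂ] _) ∘ₗ
    (map LinearMap.id (proj S.par 0) + map R.par (proj S.par 1))

theorem flip_tmul (R : SuperRep g V) (S : SuperRep g W) {i j : ZMod 2} {m : V} {n : W}
    (hm : m ∈ homog R.par i) (hn : n ∈ homog S.par j) :
    flip R S (m ⊗ₜ n) = sgn (i * j) • (n ⊗ₜ m) := by
  simp only [flip, LinearMap.comp_apply, LinearMap.add_apply, map_tmul, LinearMap.id_coe, id_eq,
    proj_of_mem hn, mem_homog.mp hm]
  rcases zmod_two_cases j with rfl | rfl <;> simp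

theorem flip_flip (R : SuperRep g V) (S : SuperRep g W) (t : V ⊗[ℂ] W) :
    flip S R (flip R S t) = t := by
  induction t using tensor_induction R.par_par S.par_par with
  | zero => simp
  | add s t hs ht => simp only [map_add, hs, ht]
  | tmul k l m hm n hn =>
    rw [flip_tmul R S hm hn, map_smul, flip_tmul S R hn hm, smul_smul, mul_comm l k, sgn_sq,
      one_smul]

/-- The flip as a linear isomorphism. -/
def flipEquiv (R : SuperRep g V) (S : SuperRep g W) : V ⊗[ℂ] W ≃ₗ[ℂ] W ⊗[ℂ] V :=
  LinearEquiv.ofLinearMap (flip R S) (flip S R) (LinearMap.ext (flip_flip S R))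
    (LinearMap.ext (flip_flip R S))

theorem isHom_flip (R : SuperRep g V) (S : SuperRep g W) :
    IsHom (R.tensor S) (S.tensor R) (flipEquiv R S : _ →ₗ[ℂ] _) := by
  refine .of_homog (fun t => ?_) (fun i a ha t => ?_)
  · change flip R S (map R.par S.par t) = map S.par R.par (flip R S t)
    induction t using tensor_induction R.par_par S.par_par with
    | zero => simp
    | add s t hs ht => simp only [map_add, hs, ht]
    | tmul k l m hm n hn =>
      rw [mem_homog.mp (tmul_mem hm hn), map_smul, flip_tmul R S hm hn, map_smul,
        mem_homog.mp (tmul_mem hn hm), add_comm, smul_comm]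
  · change flip R S (tensorAct R S a t) = tensorAct S R a (flip R S t)
    induction t using tensor_induction R.par_par S.par_par with
    | zero => simp
    | add s t hs ht => simp only [map_add, hs, ht]
    | tmul k l m hm n hn =>
      rw [tensorAct_tmul _ _ ha hm, map_add, map_smul,
        flip_tmul R S (R.act_mem ha hm) hn, flip_tmul R S hm (S.act_mem ha hn),
        flip_tmul R S hm hn, map_smul, tensorAct_tmul _ _ ha hn]
      simp only [sgn_add_mul, sgn_mul_add, mul_comm k i]
      have h2 := sgn_sq (i * k)
      generalize sgn (i * k) = s at *
      rcases mul_self_eq_one_iff.mp h2 with rfl | rfl <;> module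

variable (V) in
/-- The canonical isomorphism `ℂ ⊗ V ≃ V`. -/
def unitEquiv : ULift.{v} ℂ ⊗[ℂ] V ≃ₗ[ℂ] V :=
  (TensorProduct.congr ULift.moduleEquiv (LinearEquiv.refl ℂ V)).trans (TensorProduct.lid ℂ V)

theorem isHom_unitEquiv (R : SuperRep g V) :
    IsHom ((trivial g).tensor R) R (unitEquiv V : _ →ₗ[ℂ] _) := by
  refine .of_homog (fun t => ?_) (fun i a ha t => ?_)
  · change unitEquiv V (map LinearMap.id R.par t) = R.par (unitEquiv V t)
    induction t using TensorProduct.induction_on with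
    | zero => simp
    | add s t hs ht => simp only [map_add, hs, ht]
    | tmul c m => simp [unitEquiv]
  · change unitEquiv V (tensorAct (trivial g) R a t) = R.act a (unitEquiv V t)
    induction t using TensorProduct.induction_on with
    | zero => simp
    | add s t hs ht => simp only [map_add, hs, ht]
    | tmul c m =>
      have hc : c ∈ homog (trivial.{u, v} g).par 0 := by
        rw [mem_homog, sgn_zero, one_smul]; rfl
      rw [tensorAct_tmul _ _ ha hc]
      simp [trivial, unitEquiv]

end SuperRep

/-- A finite-dimensional `g`-module (an object of the category `F_g`). -/
structure SMod (g : Type u) [AddCommGroup g] [Module ℂ g] [LieSuperalgebra g] where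
  carrier : Type v
  [addCommGroup : AddCommGroup carrier]
  [module : Module ℂ carrier]
  [finite : FiniteDimensional ℂ carrier]
  rep : SuperRep g carrier

attribute [instance] SMod.addCommGroup SMod.module SMod.finite

namespace SMod

variable {g : Type u} [AddCommGroup g] [Module ℂ g] [LieSuperalgebra g]

/-- `0 → M₁ → M₂ → M₃ → 0` is exact. -/
def IsShortExact (M₁ M₂ M₃ : SMod.{u, v} g) : Prop :=
  ∃ (f : M₁.carrier →ₗ[ℂ] M₂.carrier) (p : M₂.carrier →ₗ[ℂ] M₃.carrier),
    SuperRep.IsHom M₁.rep M₂.rep f ∧ SuperRep.IsHom M₂.rep M₃.rep p ∧ Function.Injective f ∧ Function.Exact f p ∧ Function.Surjective p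

/-- Isomorphism of `g`-modules. -/
def Iso (M N : SMod.{u, v} g) : Prop :=
  ∃ e : M.carrier ≃ₗ[ℂ] N.carrier, SuperRep.IsHom M.rep N.rep (e : M.carrier →ₗ[ℂ] N.carrier)

/-- The tensor product of two `g`-modules. -/
def tensor (M N : SMod.{u, v} g) : SMod.{u, v} g where
  carrier := M.carrier ⊗[ℂ] N.carrier
  rep := M.rep.tensor N.rep

variable (g) in
/-- The trivial `g`-module. -/
def unit : SMod.{u, v} g where
  carrier := ULift.{v} ℂ
  rep := SuperRep.trivial g

/-- The parity shift `Π M`. -/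
def shift (M : SMod.{u, v} g) : SMod.{u, v} g where
  carrier := M.carrier
  rep := M.rep.shift

/-- The Duflo–Serganova functor on objects: `M ↦ M_x = ker x / x M`, a module over `g_x`. -/
def DS (x : SelfCommuting g) (M : SMod.{u, v} g) : SMod.{u, v} (DSAlg x) where
  carrier := M.rep.Coh x
  rep := M.rep.ds x

theorem Iso.refl (M : SMod.{u, v} g) : Iso M M := ⟨.refl ℂ _, fun _ => rfl, fun _ _ => rfl⟩

theorem Iso.symm {M N : SMod.{u, v} g} : Iso M N → Iso N M := by
  rintro ⟨e, he⟩
  refine ⟨e.symm, fun m => ?_, fun a m => ?_⟩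
  · obtain ⟨m, rfl⟩ := e.surjective m
    have := he.map_par m
    simp only [LinearEquiv.coe_coe] at this ⊢
    rw [← this]; simp
  · obtain ⟨m, rfl⟩ := e.surjective m
    have := he.map_act a m
    simp only [LinearEquiv.coe_coe] at this ⊢
    rw [← this]; simp

theorem Iso.trans {M N P : SMod.{u, v} g} : Iso M N → Iso N P → Iso M P := by
  rintro ⟨e, he⟩ ⟨f, hf⟩
  refine ⟨e.trans f, fun m => ?_, fun a m => ?_⟩
  · have h1 := he.map_par m
    have h2 := hf.map_par (e m)
    simp only [LinearEquiv.coe_coe] at h1 h2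
    simp [h1, h2]
  · have h1 := he.map_act a m
    have h2 := hf.map_act a (e m)
    simp only [LinearEquiv.coe_coe] at h1 h2
    simp [h1, h2]

theorem Iso.tensor {M N M' N' : SMod.{u, v} g} :
    Iso M M' → Iso N N' → Iso (tensor M N) (tensor M' N') := by
  rintro ⟨e, he⟩ ⟨f, hf⟩
  exact ⟨TensorProduct.congr e f, he.tensor hf⟩

theorem tensor_assoc (M N P : SMod.{u, v} g) :
    Iso (tensor (tensor M N) P) (tensor M (tensor N P)) :=
  ⟨TensorProduct.assoc ℂ M.carrier N.carrier P.carrier, M.rep.isHom_assoc N.rep P.rep⟩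

theorem tensor_comm (M N : SMod.{u, v} g) : Iso (tensor M N) (tensor N M) :=
  ⟨M.rep.flipEquiv N.rep, M.rep.isHom_flip N.rep⟩

theorem unit_tensor (M : SMod.{u, v} g) : Iso (tensor (unit g) M) M :=
  ⟨SuperRep.unitEquiv M.carrier, M.rep.isHom_unitEquiv⟩

theorem IsShortExact.tensor {M₁ M₂ M₃ : SMod.{u, v} g} (h : IsShortExact M₁ M₂ M₃)
    (N : SMod.{u, v} g) : IsShortExact (tensor N M₁) (tensor N M₂) (tensor N M₃) := by
  obtain ⟨f, p, hf, hp, inj, ex, surj⟩ := h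
  have hid : SuperRep.IsHom N.rep N.rep LinearMap.id := ⟨fun _ => rfl, fun _ _ => rfl⟩
  exact ⟨f.lTensor N.carrier, p.lTensor N.carrier, hid.tensor hf, hid.tensor hp,
    Module.Flat.lTensor_preserves_injective_linearMap f inj,
    lTensor_exact N.carrier ex surj, LinearMap.lTensor_surjective N.carrier surj⟩

variable (g) in
/-- Isomorphism classes of finite-dimensional `g`-modules. -/
instance isoSetoid : Setoid (SMod.{u, v} g) where
  r := Iso
  iseqv := ⟨Iso.refl, Iso.symm, Iso.trans⟩

end SMod

section Grothendieck

variable (g : Type u) [AddCommGroup g] [Module ℂ g] [LieSuperalgebra g]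

/-- Isomorphism classes of finite-dimensional `g`-modules. -/
def IsoClass : Type max u (v + 1) := Quotient (SMod.isoSetoid.{u, v} g)

/-- Isomorphism classes form a commutative monoid under the tensor product. -/
instance : CommMonoid (IsoClass.{u, v} g) where
  mul := Quotient.map₂ SMod.tensor (fun _ _ h _ _ h' => SMod.Iso.tensor h h')
  one := Quotient.mk _ (SMod.unit g)
  mul_assoc := by
    rintro ⟨M⟩ ⟨N⟩ ⟨P⟩
    exact Quotient.sound (SMod.tensor_assoc M N P)
  mul_comm := by
    rintro ⟨M⟩ ⟨N⟩
    exact Quotient.sound (SMod.tensor_comm M N)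
  one_mul := by
    rintro ⟨M⟩
    exact Quotient.sound (SMod.unit_tensor M)
  mul_one := by
    rintro ⟨M⟩
    exact Quotient.sound ((SMod.tensor_comm M _).trans (SMod.unit_tensor M))

variable {g} in
/-- The generator attached to `M` of the free abelian group on isomorphism classes. -/
def gen (M : SMod.{u, v} g) : FreeAbelianGroup (IsoClass.{u, v} g) :=
  FreeAbelianGroup.of (Quotient.mk _ M)

/-- The relations `[M₁] - [M₂] + [M₃]` for exact sequences `0 → M₁ → M₂ → M₃ → 0`. -/
def exactRelations : Set (FreeAbelianGroup (IsoClass.{u, v} g)) :=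
  {r | ∃ M₁ M₂ M₃ : SMod.{u, v} g, SMod.IsShortExact M₁ M₂ M₃ ∧ r = gen M₁ - gen M₂ + gen M₃}

/-- The subgroup generated by the relations of exact sequences, which is an ideal for the product
given by tensor products. -/
def exactIdeal : Ideal (FreeAbelianGroup (IsoClass.{u, v} g)) where
  carrier := AddSubgroup.closure (exactRelations.{u, v} g)
  add_mem' := add_mem
  zero_mem' := zero_mem _
  smul_mem' c r hr := by
    change c * r ∈ AddSubgroup.closure (exactRelations.{u, v} g)
    induction hr using AddSubgroup.closure_induction with
    | zero => simp
    | add r s _ _ hr hs => rw [mul_add]; exact add_mem hr hs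
    | neg r _ hr => rw [mul_neg]; exact neg_mem hr
    | mem r hr =>
      obtain ⟨M₁, M₂, M₃, h, rfl⟩ := hr
      induction c using FreeAbelianGroup.induction_on with
      | zero => simp
      | neg c hc => rw [neg_mul]; exact neg_mem hc
      | add c d hc hd => rw [add_mul]; exact add_mem hc hd
      | of c =>
        obtain ⟨N⟩ := c
        refine AddSubgroup.subset_closure ⟨_, _, _, h.tensor N, ?_⟩
        simp only [mul_add, mul_sub]
        rfl

/-- The Grothendieck ring of the category of finite-dimensional `g`-modules. -/
abbrev GrothendieckRing : Type max u (v + 1) :=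
  FreeAbelianGroup (IsoClass.{u, v} g) ⧸ exactIdeal.{u, v} g

/-- The ideal generated by all `[Π M] + [M]`. -/
def parityIdeal : Ideal (GrothendieckRing.{u, v} g) :=
  Ideal.span {r | ∃ M : SMod.{u, v} g,
    r = Ideal.Quotient.mk _ (gen M.shift) + Ideal.Quotient.mk _ (gen M)}

/-- The quotient `K_g` of the Grothendieck ring by the relations `[Π M] = -[M]`. -/
abbrev KRing : Type max u (v + 1) := GrothendieckRing.{u, v} g ⧸ parityIdeal.{u, v} g

variable {g} in
/-- The class `[M]` in `K_g`. -/
def KRing.cls (M : SMod.{u, v} g) : KRing.{u, v} g :=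
  Ideal.Quotient.mk _ (Ideal.Quotient.mk _ (gen M))

end Grothendieck

section Supercharacters

variable {g : Type u} [AddCommGroup g] [Module ℂ g] [LieSuperalgebra g]

instance (M : SMod.{u, v} g) : LieRingModule (part g 0) M.carrier := M.rep.evenLieRingModule

instance (M : SMod.{u, v} g) : LieModule ℂ (part g 0) M.carrier where
  smul_lie t a m := by
    change M.rep.act ((t • a : part g 0) : g) m = t • M.rep.act (a : g) m
    simp
  lie_smul t a m := by
    change M.rep.act (a : g) (t • m) = t • M.rep.act (a : g) m
    simp

/-- The homogeneous component `M_i^μ` of the weight space `M^μ`, for a nilpotent (for example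
Cartan) subalgebra `h` of `g_0` and `μ ∈ h^*`. Weight spaces are generalized weight spaces, so
that every finite-dimensional module has a weight decomposition; they are the ordinary weight
spaces whenever `h` acts diagonalizably. -/
def weightPart (h : LieSubalgebra ℂ (part g 0)) [LieRing.IsNilpotent h] (M : SMod.{u, v} g)
    (μ : Module.Dual ℂ h) (i : ZMod 2) : Submodule ℂ M.carrier :=
  (LieModule.genWeightSpace M.carrier (μ : h → ℂ)).toSubmodule ⊓ homog M.rep.par i

/-- The superdimension `dim M_0^μ - dim M_1^μ` of the weight space `M^μ`. -/
def weightSdim (h : LieSubalgebra ℂ (part g 0)) [LieRing.IsNilpotent h] (M : SMod.{u, v} g)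
    (μ : Module.Dual ℂ h) : ℤ :=
  (Module.finrank ℂ (weightPart h M μ 0) : ℤ) - Module.finrank ℂ (weightPart h M μ 1)

theorem finite_support_weightSdim (h : LieSubalgebra ℂ (part g 0)) [LieRing.IsNilpotent h]
    (M : SMod.{u, v} g) : (Function.support (weightSdim h M)).Finite := by
  have hfin := LieModule.finite_genWeightSpace_ne_bot ℂ h M.carrier
  refine (hfin.preimage (f := fun μ : Module.Dual ℂ h => (μ : h → ℂ))
    DFunLike.coe_injective.injOn).subset fun μ hμ => ?_
  intro hbot
  apply hμ
  have key : ∀ i, weightPart h M μ i = ⊥ := fun i => by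
    unfold weightPart
    rw [hbot]
    simp
  unfold weightSdim
  rw [key, key]
  simp

/-- The supercharacter `sch M = ∑_μ (dim M_0^μ - dim M_1^μ) e^μ` in the group ring `ℤ[h^*]`. -/
def sch (h : LieSubalgebra ℂ (part g 0)) [LieRing.IsNilpotent h] (M : SMod.{u, v} g) :
    AddMonoidAlgebra ℤ (Module.Dual ℂ h) :=
  .ofCoeff (Finsupp.ofSupportFinite (weightSdim h M) (finite_support_weightSdim h M))

/-- The supercharacter ring `J_g`, as the subring of `ℤ[h^*]` generated by the supercharacters of
all finite-dimensional `g`-modules. -/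
def JRing (h : LieSubalgebra ℂ (part g 0)) [LieRing.IsNilpotent h] :
    Subring (AddMonoidAlgebra ℤ (Module.Dual ℂ h)) :=
  Subring.closure (Set.range (sch.{u, v} h))

/-- The class `[M] = sch M` in `J_g`. -/
def JRing.cls (h : LieSubalgebra ℂ (part g 0)) [LieRing.IsNilpotent h] (M : SMod.{u, v} g) :
    JRing.{u, v} h :=
  ⟨sch h M, Subring.subset_closure ⟨M, rfl⟩⟩

/-- The restriction map `ℤ[h^*] → ℤ[t^*]`, `e^μ ↦ e^{μ ∘ ι}`, along a linear map `ι : t → h`. -/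
def restrictExp {h t : Type*} [AddCommGroup h] [Module ℂ h] [AddCommGroup t] [Module ℂ t]
    (ι : t →ₗ[ℂ] h) (F : AddMonoidAlgebra ℤ (Module.Dual ℂ h)) :
    AddMonoidAlgebra ℤ (Module.Dual ℂ t) :=
  F.mapDomain ι.dualMap

/-- `ι` embeds the subalgebra `t` of `g_x = g^x / [x,g]` into `h`: each `a ∈ t` is represented by
`ι a ∈ h ∩ g^x`. -/
def IsEmbeddingInto {x : SelfCommuting g} {h : LieSubalgebra ℂ (part g 0)}
    {t : LieSubalgebra ℂ (part (DSAlg x) 0)} (ι : t →ₗ[ℂ] h) : Prop :=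
  ∀ a : t, ∃ c : LinearMap.ker ((SuperRep.adjoint g).act x.elt),
    (c : g) = ((ι a : part g 0) : g) ∧
      (SuperRep.adjoint g).cls x c = ((a : part (DSAlg x) 0) : DSAlg x)

/-- The structure of a contragredient Lie superalgebra on `g` with Cartan subalgebra `h`:
simple roots `α_i`, coroots `h_i` and homogeneous Chevalley generators `e_i`, `f_i` such that
`h`, `e_i`, `f_i` generate `g`, the defining relations
`[h,h] = 0`, `[a,e_i] = α_i(a) e_i`, `[a,f_i] = -α_i(a) f_i`, `[e_i,f_j] = δ_ij h_i` hold, and no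
nonzero ideal of `g` intersects `h` trivially. The Cartan matrix is `A = (α_j(h_i))`. When `h` has
the minimal dimension `2n - rank A`, this says that `g` is the contragredient Lie superalgebra
`g(A)`; larger `h` (extra central directions) are allowed, which includes `gl(m|n)`, `m ≠ n`. -/
structure ContragredientData (h : LieSubalgebra ℂ (part g 0)) where
  n : ℕ
  parity : Fin n → ZMod 2
  e : Fin n → g
  f : Fin n → g
  root : Fin n → Module.Dual ℂ h
  coroot : Fin n → h
  e_mem : ∀ i, e i ∈ part g (parity i)
  f_mem : ∀ i, f i ∈ part g (parity i)
  root_linearIndependent : LinearIndependent ℂ root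
  coroot_linearIndependent : LinearIndependent ℂ coroot
  br_h_h : ∀ a b : h, br ((a : part g 0) : g) ((b : part g 0) : g) = 0
  br_h_e : ∀ (a : h) i, br ((a : part g 0) : g) (e i) = root i a • e i
  br_h_f : ∀ (a : h) i, br ((a : part g 0) : g) (f i) = -(root i a • f i)
  br_e_f : ∀ i j, br (e i) (f j) = if i = j then ((coroot i : part g 0) : g) else 0
  generate : ∀ S : Submodule ℂ g, (∀ a : h, ((a : part g 0) : g) ∈ S) → (∀ i, e i ∈ S) →
    (∀ i, f i ∈ S) → (∀ a ∈ S, ∀ b ∈ S, br a b ∈ S) → S = ⊤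
  ideal_eq_bot : ∀ I : Submodule ℂ g, (∀ a ∈ I, par a ∈ I) → (∀ b, ∀ a ∈ I, br b a ∈ I) →
    (∀ a : h, ((a : part g 0) : g) ∈ I → a = 0) → I = ⊥

end Supercharacters

end Super

end

/-! Additivity in `KRing`. Since `[x,x] = 0`, the element `x` acts on `M` with square zero and `M_x`
is its cohomology. A short exact sequence of modules gives a long exact sequence that closes up
after one turn, because `x` is odd: the cokernel of `(M₂)_x → (M₃)_x` is the parity shift of the
kernel of `(M₁)_x → (M₂)_x` (`SMod.iso_connecting`). These two terms cancel once `[ΠM] = -[M]`, so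
`[M_x]` is additive (`KRing.cls_DS_eq_add`). The Künneth isomorphism `SMod.tensor_DS` makes it
multiplicative.

Supercharacters. An element of `ℤ[h^*]` is determined by its images under `e^μ ↦ exp(μ(a)X)`, `a ∈
h` (`eq_of_expEval_eq`), and the image of `sch M` is `str_M exp(aX)` (`expEval_sch`). Identities of
supercharacters thus become identities of supertraces of powers of even elements. If `c` is even and
centralizes `x`, then the operator `par * c^k` anticommutes with `x` and has the same trace on `M`
and on `M_x` (`SMod.strPow_DS`). When `t` is embedded in `h`, this is already the restriction
formula.

For general `t`, an element of `t` has an even representative `c` in `g^x`, but `c` need not lie in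
`h`. What is needed is that `sch_h M` determines `str_M(c^k)` for every `c ∈ g_0`
(`strSeries_eq_of_sch_eq`). This function of `c` is polynomial and invariant under `exp(ad g_0)`,
and the conjugates of `h` fill a neighbourhood of a regular element of `h`; so its values on `h`
determine it. Hence `sch M ↦ sch M_x` is well defined. It is defined on the whole ring because
direct sums, tensor products and parity shifts already realize all ring operations by modules
(`coe_JRing`). -/

noncomputable section

namespace Super

open LieSuperalgebra TensorProduct

variable {g : Type u} [AddCommGroup g] [Module ℂ g] [LieSuperalgebra g]

/-! ### Submodules and quotient modules -/

namespace SMod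

/-- A graded submodule stable under the action of `g`. -/
structure IsStable (M : SMod.{u, v} g) (S : Submodule ℂ M.carrier) : Prop where
  par_mem : ∀ m ∈ S, M.rep.par m ∈ S
  act_mem : ∀ a, ∀ m ∈ S, M.rep.act a m ∈ S

/-- The representation on a stable submodule. -/
def sub (M : SMod.{u, v} g) (S : Submodule ℂ M.carrier) (hS : M.IsStable S) : SMod.{u, v} g where
  carrier := S
  rep := .mk' (M.rep.par.restrict hS.par_mem)
    (fun m => Subtype.ext (M.rep.par_par m))
    { toFun := fun a => (M.rep.act a).restrict (hS.act_mem a)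
      map_add' := fun a b => by ext m; simp
      map_smul' := fun t a => by ext m; simp }
    (fun a m => Subtype.ext (M.rep.par_act a m))
    (fun ha hb m => Subtype.ext (M.rep.act_br ha hb m))

/-- The representation on the quotient by a stable submodule. -/
def quot (M : SMod.{u, v} g) (S : Submodule ℂ M.carrier) (hS : M.IsStable S) : SMod.{u, v} g where
  carrier := M.carrier ⧸ S
  rep := .mk' (S.mapQ S M.rep.par hS.par_mem)
    (fun m => by
      obtain ⟨m, rfl⟩ := S.mkQ_surjective m
      exact congrArg S.mkQ (M.rep.par_par m))
    { toFun := fun a => S.mapQ S (M.rep.act a) (hS.act_mem a)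
      map_add' := fun a b => by ext m; simp
      map_smul' := fun t a => by ext m; simp }
    (fun a m => by
      obtain ⟨m, rfl⟩ := S.mkQ_surjective m
      exact congrArg S.mkQ (M.rep.par_act a m))
    (fun ha hb m => by
      obtain ⟨m, rfl⟩ := S.mkQ_surjective m
      exact congrArg S.mkQ (M.rep.act_br ha hb m))

theorem isStable_ker {M N : SMod.{u, v} g} {f : M.carrier →ₗ[ℂ] N.carrier}
    (hf : SuperRep.IsHom M.rep N.rep f) : M.IsStable (LinearMap.ker f) where
  par_mem m hm := by rw [LinearMap.mem_ker] at *; rw [hf.map_par, hm, map_zero]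
  act_mem a m hm := by rw [LinearMap.mem_ker] at *; rw [hf.map_act, hm, map_zero]

theorem isStable_range {M N : SMod.{u, v} g} {f : M.carrier →ₗ[ℂ] N.carrier}
    (hf : SuperRep.IsHom M.rep N.rep f) : N.IsStable (LinearMap.range f) where
  par_mem := by rintro _ ⟨m, rfl⟩; exact ⟨_, hf.map_par m⟩
  act_mem := by rintro a _ ⟨m, rfl⟩; exact ⟨_, hf.map_act a m⟩

theorem isShortExact_sub_quot (M : SMod.{u, v} g) (S : Submodule ℂ M.carrier)
    (hS : M.IsStable S) : IsShortExact (M.sub S hS) M (M.quot S hS) :=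
  ⟨S.subtype, S.mkQ, ⟨fun _ => rfl, fun _ _ => rfl⟩, ⟨fun _ => rfl, fun _ _ => rfl⟩,
    S.injective_subtype, LinearMap.exact_subtype_mkQ S, S.mkQ_surjective⟩

/-- The first isomorphism theorem as an exact sequence. It cuts the long exact sequence in
cohomology into short pieces that have relations in `KRing`. -/
theorem isShortExact_ker_range {M N : SMod.{u, v} g} {f : M.carrier →ₗ[ℂ] N.carrier}
    (hf : SuperRep.IsHom M.rep N.rep f) :
    IsShortExact (M.sub _ (isStable_ker hf)) M (N.sub _ (isStable_range hf)) :=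
  ⟨(LinearMap.ker f).subtype, f.rangeRestrict, ⟨fun _ => rfl, fun _ _ => rfl⟩,
    ⟨fun m => Subtype.ext (hf.map_par m), fun a m => Subtype.ext (hf.map_act a m)⟩,
    Submodule.injective_subtype _, fun m => by
      have h : f.rangeRestrict m = 0 ↔ m ∈ LinearMap.ker f := by
        rw [← LinearMap.ker_rangeRestrict]; rfl
      exact h.trans ⟨fun hm => ⟨⟨m, hm⟩, rfl⟩, by rintro ⟨m, rfl⟩; exact m.2⟩,
    f.surjective_rangeRestrict⟩

end SMod

/-! ### Classes in `K_g` -/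

namespace KRing

theorem cls_eq_of_iso {M N : SMod.{u, v} g} (h : SMod.Iso M N) : cls M = cls N := by
  have : gen M = gen N := congrArg FreeAbelianGroup.of (Quotient.sound h)
  rw [cls, this, cls]

theorem cls_eq_add_of_isShortExact {M₁ M₂ M₃ : SMod.{u, v} g} (h : SMod.IsShortExact M₁ M₂ M₃) :
    cls M₂ = cls M₁ + cls M₃ := by
  have h0 : Ideal.Quotient.mk (exactIdeal.{u, v} g) (gen M₁ - gen M₂ + gen M₃) = 0 :=
    Ideal.Quotient.eq_zero_iff_mem.mpr (AddSubgroup.subset_closure ⟨M₁, M₂, M₃, h, rfl⟩)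
  have h1 := congrArg (Ideal.Quotient.mk (parityIdeal.{u, v} g)) h0
  simp only [map_add, map_sub, map_zero] at h1
  change cls M₁ - cls M₂ + cls M₃ = 0 at h1
  linear_combination -h1

theorem cls_shift (M : SMod.{u, v} g) : cls M.shift = -cls M := by
  have h0 : Ideal.Quotient.mk (parityIdeal.{u, v} g)
      (Ideal.Quotient.mk _ (gen M.shift) + Ideal.Quotient.mk _ (gen M)) = 0 :=
    Ideal.Quotient.eq_zero_iff_mem.mpr (Ideal.subset_span ⟨M, rfl⟩)
  rw [map_add] at h0
  exact eq_neg_of_add_eq_zero_left h0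

theorem cls_tensor (M N : SMod.{u, v} g) : cls (M.tensor N) = cls M * cls N := by
  have : gen (M.tensor N) = gen M * gen N :=
    FreeAbelianGroup.of_mul (α := IsoClass.{u, v} g) (Quotient.mk _ M) (Quotient.mk _ N)
  rw [cls, this, map_mul, map_mul]; rfl

theorem cls_unit : cls (SMod.unit.{u, v} g) = 1 := rfl

/-- Lets exactness, an equality `ker = range` of submodules, be used for classes although the
stability proofs on the two sides differ. -/
theorem cls_sub_congr (M : SMod.{u, v} g) {S T : Submodule ℂ M.carrier} (h : S = T)
    (hS : M.IsStable S) (hT : M.IsStable T) : cls (M.sub S hS) = cls (M.sub T hT) := by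
  subst h; rfl

end KRing

/-! ### Functoriality of `M ↦ M_x` -/

namespace SuperRep

variable {V W : Type v} [AddCommGroup V] [Module ℂ V] [AddCommGroup W] [Module ℂ W]
variable {R : SuperRep g V} {S : SuperRep g W}

/-- The map on cohomology induced by a homomorphism. -/
def cohMap {f : V →ₗ[ℂ] W} (hf : IsHom R S f) (x : SelfCommuting g) : R.Coh x →ₗ[ℂ] S.Coh x :=
  Submodule.mapQ _ _
    (f.restrict (p := LinearMap.ker (R.act x.elt)) (q := LinearMap.ker (S.act x.elt))
      (fun m hm => by
        rw [LinearMap.mem_ker] at hm ⊢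
        rw [← hf.map_act, hm, map_zero]))
    (by
      rintro ⟨m, hm⟩ ⟨n, hn⟩
      change R.act x.elt n = m at hn
      refine ⟨f n, ?_⟩
      change S.act x.elt (f n) = f m
      rw [← hn, hf.map_act])

theorem cohMap_cls {f : V →ₗ[ℂ] W} (hf : IsHom R S f) (x : SelfCommuting g)
    (m : LinearMap.ker (R.act x.elt)) :
    cohMap hf x (R.cls x m) = S.cls x ⟨f m, by
      rw [LinearMap.mem_ker, ← hf.map_act, LinearMap.mem_ker.mp m.2, map_zero]⟩ := rfl

theorem isHom_cohMap {f : V →ₗ[ℂ] W} (hf : IsHom R S f) (x : SelfCommuting g) :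
    IsHom (R.ds x) (S.ds x) (cohMap hf x) where
  map_par m := by
    obtain ⟨m, rfl⟩ := R.cls_surjective x m
    change cohMap hf x (R.cohPar x _) = S.cohPar x _
    have hm : S.act x.elt (f m) = 0 := by rw [← hf.map_act, LinearMap.mem_ker.mp m.2, map_zero]
    rw [cohPar_cls _ _ _ (R.par_mem_ker x m.2), cohMap_cls, cohMap_cls,
      cohPar_cls _ _ _ (S.par_mem_ker x hm)]
    exact congrArg _ (Subtype.ext (hf.map_par m))
  map_act a m := by
    obtain ⟨m, rfl⟩ := R.cls_surjective x m
    obtain ⟨a, rfl⟩ := (adjoint g).cls_surjective x a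
    change cohMap hf x (R.cohAct x _ _) = S.cohAct x _ _
    rw [cohAct_cls, cohMap_cls, cohMap_cls, cohAct_cls]
    exact congrArg _ (Subtype.ext (hf.map_act a m))

end SuperRep

namespace SMod

theorem Iso.DS {M N : SMod.{u, v} g} (h : Iso M N) (x : SelfCommuting g) :
    Iso (M.DS x) (N.DS x) := by
  obtain ⟨e, he⟩ := h
  refine ⟨LinearEquiv.ofBijective (SuperRep.cohMap he x) ⟨?_, ?_⟩, SuperRep.isHom_cohMap he x⟩
  · rw [injective_iff_map_eq_zero]
    intro m hm
    obtain ⟨m, rfl⟩ := M.rep.cls_surjective x m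
    rw [SuperRep.cohMap_cls, SuperRep.cls_eq_zero] at hm
    obtain ⟨n, hn⟩ := hm
    obtain ⟨n, rfl⟩ := e.surjective n
    rw [SuperRep.cls_eq_zero]
    exact ⟨n, e.injective ((he.map_act _ _).trans hn)⟩
  · intro n
    obtain ⟨n, rfl⟩ := N.rep.cls_surjective x n
    obtain ⟨m, hm⟩ := e.surjective (n : N.carrier)
    have hm' : M.rep.act x.elt m = 0 := e.injective (by
      rw [map_zero]
      refine (he.map_act _ _).trans ?_
      rw [LinearEquiv.coe_coe, hm]; exact n.2)
    exact ⟨M.rep.cls x ⟨m, hm'⟩, by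
      rw [SuperRep.cohMap_cls]; exact congrArg _ (Subtype.ext hm)⟩

/-- The shift leaves the action untouched, so the cohomology is literally the same space and only
the sign of the parity involution changes. -/
theorem shift_DS (M : SMod.{u, v} g) (x : SelfCommuting g) :
    Iso (M.shift.DS x) (M.DS x).shift := by
  refine ⟨LinearEquiv.refl ℂ (M.rep.Coh x), fun m => ?_, fun a m => rfl⟩
  obtain ⟨m, rfl⟩ := M.rep.cls_surjective x m
  exact map_neg (M.rep.cls x) ⟨M.rep.par m, M.rep.par_mem_ker x m.2⟩

/-- On the trivial module `x` acts by zero, so every vector is a cycle and only `0` is a boundary.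
-/
theorem unit_DS (x : SelfCommuting g) :
    Iso ((unit.{u, v} g).DS x) (unit.{u, v} (DSAlg x)) := by
  let f : ULift.{v} ℂ →ₗ[ℂ] (unit.{u, v} g).rep.Coh x :=
    (unit.{u, v} g).rep.cls x ∘ₗ LinearMap.codRestrict _ LinearMap.id (fun m => rfl)
  have hf : Function.Bijective f := by
    constructor
    · rw [injective_iff_map_eq_zero]
      intro m hm
      obtain ⟨n, hn⟩ := (SuperRep.cls_eq_zero _ _).mp hm
      exact hn.symm
    · intro m
      obtain ⟨m, rfl⟩ := (unit.{u, v} g).rep.cls_surjective x m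
      exact ⟨m.1, rfl⟩
  refine Iso.symm ⟨LinearEquiv.ofBijective f hf, fun m => rfl, fun a m => ?_⟩
  obtain ⟨a, rfl⟩ := (SuperRep.adjoint g).cls_surjective x a
  change f 0 = (unit.{u, v} g).rep.cohAct x _ ((unit.{u, v} g).rep.cls x ⟨m, rfl⟩)
  rw [SuperRep.cohAct_cls]
  rfl

end SMod

/-! ### The Euler characteristic of the long exact sequence -/

/-- For odd `x` the bracket `[x,x]` acts as twice the square of `x`. -/
theorem SuperRep.act_x_act_x {V : Type v} [AddCommGroup V] [Module ℂ V] (R : SuperRep g V)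
    (x : SelfCommuting g) (m : V) : R.act x.elt (R.act x.elt m) = 0 := by
  have h := R.act_br_x x x.elt m
  rw [x.sq, mem_homog.mp x.odd] at h
  simp only [map_zero, LinearMap.zero_apply, sgn_one, neg_smul, one_smul, map_neg,
    LinearMap.neg_apply, sub_neg_eq_add] at h
  have h2 : (2 : ℂ) • R.act x.elt (R.act x.elt m) = 0 := by rw [two_smul]; exact h.symm
  simpa using h2

/-- Gives the connecting isomorphism from two quotient maps of one space of lifts, so that its
compatibilities can be checked on lifts. -/
theorem exists_linearEquiv_of_ker_eq {Q C K : Type*} [AddCommGroup Q] [Module ℂ Q]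
    [AddCommGroup C] [Module ℂ C] [AddCommGroup K] [Module ℂ K] {p : Q →ₗ[ℂ] C} {q : Q →ₗ[ℂ] K}
    (hp : Function.Surjective p) (hq : Function.Surjective q)
    (h : LinearMap.ker p = LinearMap.ker q) : ∃ e : C ≃ₗ[ℂ] K, ∀ z, e (p z) = q z := by
  refine ⟨(p.quotKerEquivOfSurjective hp).symm ≪≫ₗ Submodule.quotEquivOfEq _ _ h ≪≫ₗ
    q.quotKerEquivOfSurjective hq, fun z => ?_⟩
  have : (p.quotKerEquivOfSurjective hp).symm (p z) = Submodule.Quotient.mk z := by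
    rw [LinearEquiv.symm_apply_eq]; rfl
  simp only [LinearEquiv.trans_apply, this]
  rfl

namespace SMod

variable {M₁ M₂ M₃ : SMod.{u, v} g} {f : M₁.carrier →ₗ[ℂ] M₂.carrier}
  {p : M₂.carrier →ₗ[ℂ] M₃.carrier}

/-- The connecting isomorphism of the long exact sequence: it identifies the cokernel of
`(M₂)_x → (M₃)_x` with the parity shift of the kernel of `(M₁)_x → (M₂)_x`. -/
theorem iso_connecting (hf : SuperRep.IsHom M₁.rep M₂.rep f) (hp : SuperRep.IsHom M₂.rep M₃.rep p)
    (inj : Function.Injective f) (ex : Function.Exact f p) (surj : Function.Surjective p)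
    (x : SelfCommuting g) :
    Iso ((M₃.DS x).quot _ (isStable_range (M := M₂.DS x) (SuperRep.isHom_cohMap hp x)))
      ((M₁.DS x).sub _ (isStable_ker (N := M₂.DS x) (SuperRep.isHom_cohMap hf x))).shift := by
  let d₁ := M₁.rep.act x.elt
  let d₂ := M₂.rep.act x.elt
  let d₃ := M₃.rep.act x.elt
  -- The vectors of `M₂` that lift cycles of `M₃`.
  let Q : Submodule ℂ M₂.carrier := LinearMap.ker (d₃ ∘ₗ p)
  have hQ : ∀ q : Q, d₃ (p q) = 0 := fun q => q.2
  have hrange : ∀ q : Q, (d₂ ∘ₗ M₂.rep.par) q ∈ LinearMap.range f := fun q => by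
    refine (ex _).mp ?_
    change p (d₂ (M₂.rep.par q)) = 0
    rw [hp.map_act, hp.map_par]
    exact M₃.rep.par_mem_ker x (hQ q)
  -- The usual connecting map is `q ↦ f⁻¹(d₂ q)`. It commutes with the action of `g^x` only up to
  -- sign; inserting `par` before `d₂` removes that sign, and the map then intertwines the untwisted
  -- action used by `shift`.
  let w : Q →ₗ[ℂ] M₁.carrier := (LinearEquiv.ofInjective f inj).symm.toLinearMap ∘ₗ
    LinearMap.codRestrict _ ((d₂ ∘ₗ M₂.rep.par) ∘ₗ Q.subtype) hrange
  have hw : ∀ q : Q, f (w q) = d₂ (M₂.rep.par q) := fun q =>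
    congrArg Subtype.val ((LinearEquiv.ofInjective f inj).apply_symm_apply ⟨_, hrange q⟩)
  have hdw : ∀ q : Q, d₁ (w q) = 0 := fun q => inj (by
    rw [hf.map_act, hw, map_zero]; exact M₂.rep.act_x_act_x x _)
  have hker : ∀ q : Q, M₁.rep.cls x ⟨w q, hdw q⟩ ∈ LinearMap.ker (SuperRep.cohMap hf x) :=
    fun q => by
      rw [LinearMap.mem_ker, SuperRep.cohMap_cls, SuperRep.cls_eq_zero]
      exact ⟨_, (hw q).symm⟩
  let N := (M₃.DS x).quot _ (isStable_range (M := M₂.DS x) (SuperRep.isHom_cohMap hp x))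
  let K := (M₁.DS x).sub _ (isStable_ker (N := M₂.DS x) (SuperRep.isHom_cohMap hf x))
  let a : Q →ₗ[ℂ] N.carrier := (LinearMap.range (SuperRep.cohMap hp x)).mkQ ∘ₗ M₃.rep.cls x ∘ₗ
    LinearMap.codRestrict _ (p ∘ₗ Q.subtype) hQ
  let b : Q →ₗ[ℂ] K.carrier := LinearMap.codRestrict _
    (M₁.rep.cls x ∘ₗ LinearMap.codRestrict _ w hdw) hker
  have ha : Function.Surjective a := fun n => by
    obtain ⟨n, rfl⟩ := Submodule.mkQ_surjective _ n
    obtain ⟨n, rfl⟩ := M₃.rep.cls_surjective x n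
    obtain ⟨m, hm⟩ := surj (n : M₃.carrier)
    exact ⟨⟨m, by change d₃ (p m) = 0; rw [hm]; exact n.2⟩,
      congrArg (LinearMap.range (SuperRep.cohMap hp x)).mkQ
        (congrArg (M₃.rep.cls x) (Subtype.ext hm))⟩
  have hb : Function.Surjective b := by
    rintro ⟨n, hn⟩
    obtain ⟨n, rfl⟩ := M₁.rep.cls_surjective x n
    obtain ⟨m, hm⟩ := (SuperRep.cls_eq_zero _ _).mp hn
    change d₂ m = f n at hm
    have hm' : M₂.rep.par m ∈ Q := by
      change d₃ (p (M₂.rep.par m)) = 0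
      rw [hp.map_par]
      refine M₃.rep.par_mem_ker x ?_
      rw [← hp.map_act]
      change p (d₂ m) = 0
      rw [hm]
      exact (ex _).mpr ⟨_, rfl⟩
    refine ⟨⟨M₂.rep.par m, hm'⟩, Subtype.ext (congrArg (M₁.rep.cls x) (Subtype.ext (inj ?_)))⟩
    refine (hw _).trans ?_
    rw [M₂.rep.par_par, hm]
  -- Both kernels are shown to be `ker d₂ + im f`.
  have hab : LinearMap.ker a = LinearMap.ker b := by
    ext q
    have h1 : q ∈ LinearMap.ker a ↔ ∃ z m, d₂ z = 0 ∧ (q : M₂.carrier) = z + f m := by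
      rw [LinearMap.mem_ker]
      refine (Submodule.Quotient.mk_eq_zero _).trans ⟨?_, ?_⟩
      · rintro ⟨z, hz⟩
        obtain ⟨z, rfl⟩ := M₂.rep.cls_surjective x z
        rw [SuperRep.cohMap_cls] at hz
        have h0 := sub_eq_zero.mpr hz.symm
        change M₃.rep.cls x ⟨p q, hQ q⟩ - _ = 0 at h0
        rw [← map_sub, SuperRep.cls_eq_zero] at h0
        obtain ⟨n, hn⟩ := h0
        obtain ⟨n, rfl⟩ := surj n
        change d₃ (p n) = p q - p z at hn
        have : p (q - z - d₂ n) = 0 := by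
          rw [map_sub, map_sub, hp.map_act, ← hn]; exact sub_self _
        obtain ⟨m, hm⟩ := (ex _).mp this
        -- The classes of `p q` and `p z` differ by the boundary `d₃ (p n)`; lifting it to `d₂ n`
        -- leaves `q - z - d₂ n` in `ker p = im f`.
        refine ⟨z + d₂ n, m, ?_, ?_⟩
        · rw [map_add]
          exact (congrArg₂ (· + ·) z.2 (M₂.rep.act_x_act_x x n)).trans (add_zero _)
        · rw [hm]; abel
      · rintro ⟨z, m, hz, hq⟩
        refine ⟨M₂.rep.cls x ⟨z, hz⟩, ?_⟩
        rw [SuperRep.cohMap_cls]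
        refine congrArg (M₃.rep.cls x) (Subtype.ext ?_)
        change p z = p q
        rw [hq, map_add, (ex (f m)).mpr ⟨m, rfl⟩, add_zero]
    have h2 : q ∈ LinearMap.ker b ↔ ∃ z m, d₂ z = 0 ∧ (q : M₂.carrier) = z + f m := by
      have : q ∈ LinearMap.ker b ↔ M₁.rep.cls x ⟨w q, hdw q⟩ = 0 := by
        rw [LinearMap.mem_ker]
        exact Subtype.ext_iff
      rw [this, SuperRep.cls_eq_zero]
      constructor
      · rintro ⟨m, hm⟩
        change d₁ m = w q at hm
        have h0 : d₂ (M₂.rep.par q - f m) = 0 := by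
          rw [map_sub, ← hw, ← hm, hf.map_act]; exact sub_self _
        refine ⟨M₂.rep.par (M₂.rep.par q - f m), M₁.rep.par m, M₂.rep.par_mem_ker x h0, ?_⟩
        rw [hf.map_par, map_sub, M₂.rep.par_par]; abel
      · rintro ⟨z, m, hz, hq⟩
        refine ⟨M₁.rep.par m, inj ?_⟩
        rw [hf.map_act, hf.map_par]
        change d₂ (M₂.rep.par (f m)) = f (w q)
        have hz' : d₂ (M₂.rep.par z) = 0 := M₂.rep.par_mem_ker x hz
        rw [hw, hq, map_add, map_add, hz', zero_add]
    rw [h1, h2]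
  obtain ⟨e, he⟩ := exists_linearEquiv_of_ker_eq ha hb hab
  refine ⟨e, fun n => ?_, fun c n => ?_⟩
  · obtain ⟨q, rfl⟩ := ha n
    have hq : M₂.rep.par q ∈ Q := by
      change d₃ (p (M₂.rep.par q)) = 0
      rw [hp.map_par]
      exact M₃.rep.par_mem_ker x (hQ q)
    have h1 : N.rep.par (a q) = a ⟨M₂.rep.par q, hq⟩ :=
      congrArg (LinearMap.range (SuperRep.cohMap hp x)).mkQ
        (congrArg (M₃.rep.cls x) (Subtype.ext (hp.map_par q).symm))
    change e (N.rep.par (a q)) = -K.rep.par (e (a q))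
    rw [h1, he, he]
    have h2 : b ⟨M₂.rep.par q, hq⟩ = -K.rep.par (b q) := by
      refine Subtype.ext ?_
      change M₁.rep.cls x ⟨w _, _⟩ = -M₁.rep.cohPar x (M₁.rep.cls x ⟨w q, hdw q⟩)
      rw [SuperRep.cohPar_cls _ _ _ (M₁.rep.par_mem_ker x (hdw q)), ← map_neg]
      refine congrArg (M₁.rep.cls x) (Subtype.ext (inj ?_))
      change f (w _) = f (-M₁.rep.par (w q))
      rw [hw, map_neg, hf.map_par, hw, M₂.rep.par_x, M₂.rep.par_par, neg_neg]
    rw [h2]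
  · obtain ⟨q, rfl⟩ := ha n
    obtain ⟨c, rfl⟩ := (SuperRep.adjoint g).cls_surjective x c
    have hq : M₂.rep.act (c : g) q ∈ Q := by
      change d₃ (p (M₂.rep.act (c : g) q)) = 0
      rw [hp.map_act]
      exact M₃.rep.act_mem_ker x c.2 (hQ q)
    have h1 : N.rep.act ((SuperRep.adjoint g).cls x c) (a q) = a ⟨M₂.rep.act (c : g) q, hq⟩ :=
      congrArg (LinearMap.range (SuperRep.cohMap hp x)).mkQ
        (congrArg (M₃.rep.cls x) (Subtype.ext (hp.map_act _ q).symm))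
    change e (N.rep.act ((SuperRep.adjoint g).cls x c) (a q)) =
      K.rep.act ((SuperRep.adjoint g).cls x c) (e (a q))
    rw [h1, he, he]
    refine Subtype.ext ?_
    change M₁.rep.cls x ⟨w ⟨M₂.rep.act (c : g) q, hq⟩, hdw _⟩ =
      M₁.rep.cohAct x ((SuperRep.adjoint g).cls x c) (M₁.rep.cls x ⟨w q, hdw q⟩)
    rw [SuperRep.cohAct_cls]
    refine congrArg (M₁.rep.cls x) (Subtype.ext (inj ?_))
    change f (w _) = f (M₁.rep.act (c : g) (w q))
    rw [hw, hf.map_act, hw]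
    change d₂ (M₂.rep.par (M₂.rep.act (c : g) q)) = _
    rw [M₂.rep.par_act]
    exact (M₂.rep.act_x_comm x c.2 _).symm

/-- Exactness in the middle of the long exact sequence. -/
theorem ker_cohMap_eq_range (hf : SuperRep.IsHom M₁.rep M₂.rep f)
    (hp : SuperRep.IsHom M₂.rep M₃.rep p) (inj : Function.Injective f) (ex : Function.Exact f p)
    (surj : Function.Surjective p) (x : SelfCommuting g) :
    LinearMap.ker (SuperRep.cohMap hp x) = LinearMap.range (SuperRep.cohMap hf x) := by
  ext m
  obtain ⟨m, rfl⟩ := M₂.rep.cls_surjective x m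
  rw [LinearMap.mem_ker, SuperRep.cohMap_cls, SuperRep.cls_eq_zero]
  constructor
  · rintro ⟨n, hn⟩
    obtain ⟨n, rfl⟩ := surj n
    change M₃.rep.act x.elt (p n) = p m at hn
    have : p (m - M₂.rep.act x.elt n) = 0 := by rw [map_sub, hp.map_act, hn, sub_self]
    obtain ⟨l, hl⟩ := (ex _).mp this
    have hdl : M₁.rep.act x.elt l = 0 := inj (by
      rw [hf.map_act, hl, map_sub, M₂.rep.act_x_act_x, LinearMap.mem_ker.mp m.2, sub_zero,
        map_zero])
    refine ⟨M₁.rep.cls x ⟨l, hdl⟩, ?_⟩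
    rw [SuperRep.cohMap_cls, ← sub_eq_zero, ← map_sub, SuperRep.cls_eq_zero]
    refine ⟨-n, ?_⟩
    change _ = f l - m
    rw [hl, map_neg]; abel
  · rintro ⟨l, hl⟩
    obtain ⟨l, rfl⟩ := M₁.rep.cls_surjective x l
    rw [SuperRep.cohMap_cls, ← sub_eq_zero, ← map_sub, SuperRep.cls_eq_zero] at hl
    obtain ⟨n, hn⟩ := hl
    change M₂.rep.act x.elt n = f l - m at hn
    refine ⟨-p n, ?_⟩
    change _ = p m
    rw [map_neg, ← hp.map_act, hn, map_sub, (ex (f l)).mpr ⟨_, rfl⟩]; abel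

end SMod

/-- The class of `M_x` is additive on short exact sequences. -/
theorem KRing.cls_DS_eq_add {M₁ M₂ M₃ : SMod.{u, v} g} (h : SMod.IsShortExact M₁ M₂ M₃)
    (x : SelfCommuting g) : cls (M₂.DS x) = cls (M₁.DS x) + cls (M₃.DS x) := by
  obtain ⟨f, p, hf, hp, inj, ex, surj⟩ := h
  have hf' := SuperRep.isHom_cohMap hf x
  have hp' := SuperRep.isHom_cohMap hp x
  have h1 := cls_eq_add_of_isShortExact
    (SMod.isShortExact_ker_range (M := M₁.DS x) (N := M₂.DS x) hf')
  have h2 := cls_eq_add_of_isShortExact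
    (SMod.isShortExact_ker_range (M := M₂.DS x) (N := M₃.DS x) hp')
  have h3 := cls_eq_add_of_isShortExact (SMod.isShortExact_sub_quot (M₃.DS x) _
    (SMod.isStable_range (M := M₂.DS x) hp'))
  have h4 := cls_eq_of_iso (SMod.iso_connecting hf hp inj ex surj x)
  have h5 := cls_sub_congr (M₂.DS x) (SMod.ker_cohMap_eq_range hf hp inj ex surj x)
    (SMod.isStable_ker (N := M₃.DS x) hp') (SMod.isStable_range (M := M₁.DS x) hf')
  rw [cls_shift] at h4
  -- Here `k`, `i` are the kernel and image of `(M₁)_x → (M₂)_x`, and `r`, `q` the image and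
  -- cokernel of `(M₂)_x → (M₃)_x`. Exactness makes `i` also the kernel of the second map, and the
  -- connecting isomorphism gives `q = -k`.
  have key : ∀ {m₁ m₂ m₃ k i r q : KRing.{u, v} (DSAlg x)}, m₁ = k + i → m₂ = i + r →
      m₃ = r + q → q = -k → m₂ = m₁ + m₃ := by
    rintro _ _ _ k i r _ rfl rfl rfl rfl; ring
  exact key h1 (h2.trans (congrArg (· + _) h5)) h3 h4

/-! ### The Künneth isomorphism -/

/-- A linear section of `d` over its range, extended to the whole space. -/
theorem exists_pseudoInverse {V : Type*} [AddCommGroup V] [Module ℂ V] (d : V →ₗ[ℂ] V) :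
    ∃ s : V →ₗ[ℂ] V, ∀ m, d (s (d m)) = d m := by
  obtain ⟨s₀, hs₀⟩ := d.rangeRestrict.exists_rightInverse_of_surjective d.range_rangeRestrict
  obtain ⟨s, hs⟩ := s₀.exists_extend
  refine ⟨s, fun m => ?_⟩
  have h1 : s (d m) = s₀ (d.rangeRestrict m) := LinearMap.congr_fun hs (d.rangeRestrict m)
  rw [h1]
  exact congrArg Subtype.val (LinearMap.congr_fun hs₀ (d.rangeRestrict m))

namespace SuperRep

variable {V W : Type v} [AddCommGroup V] [Module ℂ V] [AddCommGroup W] [Module ℂ W]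

/-- Since `par` anticommutes with `x`, `-par s par` is a pseudo-inverse whenever `s` is; the average
of the two is odd. -/
theorem exists_odd_pseudoInverse (R : SuperRep g V) (x : SelfCommuting g) :
    ∃ s : V →ₗ[ℂ] V, (∀ m, R.act x.elt (s (R.act x.elt m)) = R.act x.elt m) ∧
      ∀ m, s (R.par m) = -R.par (s m) := by
  obtain ⟨s, hs⟩ := exists_pseudoInverse (R.act x.elt)
  refine ⟨(1 / 2 : ℂ) • (s - R.par ∘ₗ s ∘ₗ R.par), fun m => ?_, fun m => ?_⟩
  · have h1 : R.act x.elt (R.par (s (R.par (R.act x.elt m)))) = -R.act x.elt m := by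
      have h2 : ∀ v, R.act x.elt (R.par v) = -R.par (R.act x.elt v) := fun v => by
        rw [R.par_x, neg_neg]
      rw [h2, R.par_x x m, map_neg, map_neg, hs, map_neg, neg_neg, R.par_x, R.par_par]
    simp only [LinearMap.smul_apply, LinearMap.sub_apply, LinearMap.comp_apply, map_smul, map_sub,
      hs, h1]
    module
  · simp only [LinearMap.smul_apply, LinearMap.sub_apply, LinearMap.comp_apply, map_smul, map_sub,
      R.par_par]
    module

theorem tensor_act_odd (R : SuperRep g V) (S : SuperRep g W) {a : g} (ha : a ∈ part g 1) (m : V)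
    (n : W) : (R.tensor S).act a (m ⊗ₜ n) = R.act a m ⊗ₜ n + R.par m ⊗ₜ S.act a n := by
  change tensorAct R S a (m ⊗ₜ n) = _
  simp [tensorAct, proj_of_mem ha]

theorem tensor_act_even (R : SuperRep g V) (S : SuperRep g W) {a : g} (ha : a ∈ part g 0) :
    (R.tensor S).act a = map (R.act a) LinearMap.id + map LinearMap.id (S.act a) := by
  change tensorAct R S a = _
  simp [tensorAct, proj_of_mem ha]

/-- The operator `1 - d s - s d`, homotopic to the identity. -/
def cohProj (R : SuperRep g V) (x : SelfCommuting g) (s : V →ₗ[ℂ] V) : V →ₗ[ℂ] V :=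
  LinearMap.id - R.act x.elt ∘ₗ s - s ∘ₗ R.act x.elt

theorem cohProj_apply (R : SuperRep g V) (x : SelfCommuting g) (s : V →ₗ[ℂ] V) (m : V) :
    R.cohProj x s m = m - R.act x.elt (s m) - s (R.act x.elt m) := rfl

theorem act_cohProj (R : SuperRep g V) (x : SelfCommuting g) {s : V →ₗ[ℂ] V}
    (hs : ∀ m, R.act x.elt (s (R.act x.elt m)) = R.act x.elt m) (m : V) :
    R.act x.elt (R.cohProj x s m) = 0 := by
  simp only [cohProj_apply, map_sub, hs, act_x_act_x]
  abel

theorem cohProj_act (R : SuperRep g V) (x : SelfCommuting g) {s : V →ₗ[ℂ] V}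
    (hs : ∀ m, R.act x.elt (s (R.act x.elt m)) = R.act x.elt m) (m : V) :
    R.cohProj x s (R.act x.elt m) = 0 := by
  simp [cohProj_apply, hs, act_x_act_x]

/-- On a cycle `m` the operator `1 - d s - s d` changes `m` only by the boundary `-d (s m)`. -/
theorem cls_cohProj (R : SuperRep g V) (x : SelfCommuting g) {s : V →ₗ[ℂ] V}
    (hs : ∀ m, R.act x.elt (s (R.act x.elt m)) = R.act x.elt m)
    (m : LinearMap.ker (R.act x.elt)) :
    R.cls x ⟨R.cohProj x s m, R.act_cohProj x hs m⟩ = R.cls x m := by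
  refine sub_eq_zero.mp ?_
  rw [← map_sub, cls_eq_zero]
  refine ⟨-s m, ?_⟩
  change _ = R.cohProj x s m - (m : V)
  rw [cohProj_apply, LinearMap.mem_ker.mp m.2, map_zero, map_neg]
  abel

theorem par_cohProj (R : SuperRep g V) (x : SelfCommuting g) {s : V →ₗ[ℂ] V}
    (hs : ∀ m, s (R.par m) = -R.par (s m)) (m : V) :
    R.cohProj x s (R.par m) = R.par (R.cohProj x s m) := by
  have h2 : ∀ v, R.act x.elt (R.par v) = -R.par (R.act x.elt v) := fun v => by
    rw [R.par_x, neg_neg]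
  simp [cohProj_apply, hs, h2]

/-- On a tensor product the identity is homotopic to the tensor product of the projections. -/
theorem exists_tensor_homotopy (R : SuperRep g V) (S : SuperRep g W) (x : SelfCommuting g)
    {s : V →ₗ[ℂ] V} {s' : W →ₗ[ℂ] W}
    (hs : ∀ m, R.act x.elt (s (R.act x.elt m)) = R.act x.elt m)
    (hs' : ∀ m, s (R.par m) = -R.par (s m)) :
    ∃ H : V ⊗[ℂ] W →ₗ[ℂ] V ⊗[ℂ] W, ∀ z, (R.tensor S).act x.elt (H z) +
      H ((R.tensor S).act x.elt z) = z - map (R.cohProj x s) (S.cohProj x s') z := by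
  -- With `p`, `p'` the operators `1 - d s - s d` of the two factors, `1 - p ⊗ p' = (1 - p) ⊗ 1 + p
  -- ⊗ (1 - p')`, and the two summands of `H` contract these two terms. The factor `par` is the
  -- Koszul sign for moving `s'` past the first tensor factor.
  refine ⟨map s LinearMap.id + map (R.par ∘ₗ R.cohProj x s) s', fun z => ?_⟩
  induction z using TensorProduct.induction_on with
  | zero => simp
  | add y z hy hz =>
    have := congrArg₂ (· + ·) hy hz
    simp only [map_add] at this ⊢
    rw [add_add_add_comm, this]; abel
  | tmul m n =>
    have h2 : ∀ v, R.act x.elt (R.par v) = -R.par (R.act x.elt v) := fun v => by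
      rw [R.par_x, neg_neg]
    simp only [LinearMap.add_apply, map_tmul, LinearMap.id_coe, id_eq, LinearMap.comp_apply,
      map_add, tensor_act_odd R S x.odd, R.par_cohProj x hs', R.par_par, hs', h2,
      R.act_cohProj x hs, R.cohProj_act x hs, map_zero, neg_zero, TensorProduct.zero_tmul]
    rw [S.cohProj_apply x s' n, TensorProduct.tmul_sub, TensorProduct.tmul_sub]
    have h3 : m ⊗ₜ[ℂ] n = R.cohProj x s m ⊗ₜ[ℂ] n + R.act x.elt (s m) ⊗ₜ[ℂ] n +
        s (R.act x.elt m) ⊗ₜ[ℂ] n := by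
      rw [← TensorProduct.add_tmul, ← TensorProduct.add_tmul, R.cohProj_apply x s m]
      congr 1; abel
    rw [h3, TensorProduct.neg_tmul]
    abel

/-- The map `[m] ⊗ [n] ↦ [m ⊗ n]` is built from linear choices of representatives. Sending a vector
to the class of its image under `1 - d s - s d` in each factor gives a left inverse; surjectivity
follows because the tensor product of these two operators is homotopic to the identity. -/
theorem exists_kunneth (R : SuperRep g V) (S : SuperRep g W) (x : SelfCommuting g) :
    ∃ e : R.Coh x ⊗[ℂ] S.Coh x ≃ₗ[ℂ] (R.tensor S).Coh x,
      ∀ (m : LinearMap.ker (R.act x.elt)) (n : LinearMap.ker (S.act x.elt))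
        (h : (R.tensor S).act x.elt (m ⊗ₜ n) = 0),
        e (R.cls x m ⊗ₜ S.cls x n) = (R.tensor S).cls x ⟨m ⊗ₜ n, h⟩ := by
  obtain ⟨σ, hσ⟩ := (R.cls x).exists_rightInverse_of_surjective
    (LinearMap.range_eq_top.mpr (R.cls_surjective x))
  obtain ⟨σ', hσ'⟩ := (S.cls x).exists_rightInverse_of_surjective
    (LinearMap.range_eq_top.mpr (S.cls_surjective x))
  replace hσ := LinearMap.congr_fun hσ
  replace hσ' := LinearMap.congr_fun hσ'
  obtain ⟨s, hs, hsp⟩ := R.exists_odd_pseudoInverse x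
  obtain ⟨s', hs', -⟩ := S.exists_odd_pseudoInverse x
  obtain ⟨H, hH⟩ := R.exists_tensor_homotopy S x (s' := s') hs hsp
  let D := (R.tensor S).act x.elt
  have hD : ∀ m n, D (m ⊗ₜ n) = R.act x.elt m ⊗ₜ n + R.par m ⊗ₜ S.act x.elt n :=
    fun m n => R.tensor_act_odd S x.odd m n
  have hDker : ∀ {m n}, R.act x.elt m = 0 → S.act x.elt n = 0 → D (m ⊗ₜ n) = 0 := by
    intro m n hm hn
    rw [hD, hm, hn, TensorProduct.zero_tmul, TensorProduct.tmul_zero, add_zero]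
  let j : R.Coh x →ₗ[ℂ] V := (LinearMap.ker (R.act x.elt)).subtype ∘ₗ σ
  let j' : S.Coh x →ₗ[ℂ] W := (LinearMap.ker (S.act x.elt)).subtype ∘ₗ σ'
  have hj : ∀ t, D (map j j' t) = 0 := fun t => by
    induction t using TensorProduct.induction_on with
    | zero => simp
    | add s t hs ht => rw [map_add, map_add, hs, ht, add_zero]
    | tmul m n => exact hDker (σ m).2 (σ' n).2
  let Φ : R.Coh x ⊗[ℂ] S.Coh x →ₗ[ℂ] (R.tensor S).Coh x :=
    (R.tensor S).cls x ∘ₗ LinearMap.codRestrict _ (map j j') hj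
  have hΦ : ∀ (m : LinearMap.ker (R.act x.elt)) (n : LinearMap.ker (S.act x.elt))
        (h : D (m ⊗ₜ n) = 0), Φ (R.cls x m ⊗ₜ S.cls x n) = (R.tensor S).cls x ⟨m ⊗ₜ n, h⟩ := by
    intro m n h
    rw [← sub_eq_zero]
    have h1 : R.cls x (σ (R.cls x m) - m) = 0 := by rw [map_sub, sub_eq_zero]; exact hσ _
    have h2 : S.cls x (σ' (S.cls x n) - n) = 0 := by rw [map_sub, sub_eq_zero]; exact hσ' _
    obtain ⟨a, ha⟩ := (R.cls_eq_zero x).mp h1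
    obtain ⟨b, hb⟩ := (S.cls_eq_zero x).mp h2
    change (R.tensor S).cls x _ - _ = 0
    rw [← map_sub, cls_eq_zero]
    -- With `da = σ[m] - m` and `db = σ'[n] - n`, the differential of this element is `(σ[m] - m) ⊗
    -- σ'[n] + m ⊗ (σ'[n] - n)`, which telescopes.
    refine ⟨a ⊗ₜ (σ' (S.cls x n) : W) + R.par m ⊗ₜ b, ?_⟩
    have h3 : R.act x.elt (R.par m) = 0 := R.par_mem_ker x m.2
    have h4 : S.act x.elt (σ' (S.cls x n)) = 0 := (σ' (S.cls x n)).2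
    change D _ = (σ (R.cls x m) : V) ⊗ₜ (σ' (S.cls x n) : W) - (m : V) ⊗ₜ (n : W)
    rw [map_add, hD, hD, h3, h4, R.par_par, ha, hb]
    simp only [Submodule.coe_sub, TensorProduct.sub_tmul, TensorProduct.tmul_sub,
      TensorProduct.zero_tmul, TensorProduct.tmul_zero]
    abel
  let q : V →ₗ[ℂ] R.Coh x := R.cls x ∘ₗ LinearMap.codRestrict _ (R.cohProj x s) (R.act_cohProj x hs)
  let q' : W →ₗ[ℂ] S.Coh x :=
    S.cls x ∘ₗ LinearMap.codRestrict _ (S.cohProj x s') (S.act_cohProj x hs')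
  have hqj : ∀ m, q (j m) = m := fun m =>
    (R.cls_cohProj x hs (σ m)).trans (hσ m)
  have hqj' : ∀ m, q' (j' m) = m := fun m =>
    (S.cls_cohProj x hs' (σ' m)).trans (hσ' m)
  have hqd : ∀ m, q (R.act x.elt m) = 0 := fun m =>
    (congrArg (R.cls x) (Subtype.ext (R.cohProj_act x hs m))).trans (map_zero _)
  have hqd' : ∀ m, q' (S.act x.elt m) = 0 := fun m =>
    (congrArg (S.cls x) (Subtype.ext (S.cohProj_act x hs' m))).trans (map_zero _)
  have hqD : ∀ z, map q q' (D z) = 0 := fun z => by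
    induction z using TensorProduct.induction_on with
    | zero => simp
    | add s t hs ht => rw [map_add, map_add, hs, ht, add_zero]
    | tmul m n =>
      rw [hD, map_add, map_tmul, map_tmul, hqd, hqd', TensorProduct.zero_tmul,
        TensorProduct.tmul_zero, add_zero]
  refine ⟨LinearEquiv.ofBijective Φ ⟨?_, ?_⟩, hΦ⟩
  · rw [injective_iff_map_eq_zero]
    intro t ht
    obtain ⟨n, hn⟩ := ((R.tensor S).cls_eq_zero x).mp ht
    change D n = map j j' t at hn
    -- `q ⊗ q'` inverts `j ⊗ j'` and annihilates boundaries, so `t` vanishes once its representative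
    -- is a boundary.
    have h1 : map q q' (map j j' t) = t := by
      rw [← LinearMap.comp_apply, ← map_comp]
      have : q ∘ₗ j = LinearMap.id := LinearMap.ext hqj
      have : q' ∘ₗ j' = LinearMap.id := LinearMap.ext hqj'
      simp [*]
    rw [← h1, ← hn, hqD]
  · intro z
    obtain ⟨z, rfl⟩ := (R.tensor S).cls_surjective x z
    refine ⟨map q q' z, ?_⟩
    have hpp : ∀ z, D (map (R.cohProj x s) (S.cohProj x s') z) = 0 := fun z => by
      induction z using TensorProduct.induction_on with
      | zero => simp
      | add s t hs ht => rw [map_add, map_add, hs, ht, add_zero]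
      | tmul m n => exact hDker (R.act_cohProj x hs m) (S.act_cohProj x hs' n)
    have h1 : Φ ∘ₗ map q q' = (R.tensor S).cls x ∘ₗ LinearMap.codRestrict _ _ hpp :=
      TensorProduct.ext' fun m n => hΦ ⟨_, R.act_cohProj x hs m⟩ ⟨_, S.act_cohProj x hs' n⟩
        (hpp (m ⊗ₜ n))
    refine (LinearMap.congr_fun h1 z).trans (sub_eq_zero.mp ?_)
    change (R.tensor S).cls x _ - _ = 0
    rw [← map_sub, cls_eq_zero]
    refine ⟨-H z, ?_⟩
    have h2 := hH z
    rw [LinearMap.mem_ker.mp z.2, map_zero, add_zero] at h2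
    change _ = map (R.cohProj x s) (S.cohProj x s') z - (z : V ⊗[ℂ] W)
    rw [map_neg, h2, neg_sub]

/-- The sign in the tensor action depends on the parities of `a` and `m`; homogeneous
representatives carry the same parities, so the signs before and after passing to cohomology agree.
-/
theorem exists_kunneth_isHom (R : SuperRep g V) (S : SuperRep g W) (x : SelfCommuting g) :
    ∃ e : R.Coh x ⊗[ℂ] S.Coh x ≃ₗ[ℂ] (R.tensor S).Coh x,
      IsHom ((R.ds x).tensor (S.ds x)) ((R.tensor S).ds x) (e : _ →ₗ[ℂ] _) := by
  obtain ⟨e, he⟩ := R.exists_kunneth S x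
  have hker : ∀ {m n}, R.act x.elt m = 0 → S.act x.elt n = 0 →
      (R.tensor S).act x.elt (m ⊗ₜ n) = 0 := by
    intro m n hm hn
    rw [tensor_act_odd _ _ x.odd, hm, hn, TensorProduct.zero_tmul,
      TensorProduct.tmul_zero, add_zero]
  refine ⟨e, .of_homog (fun t => ?_) (fun i a ha t => ?_)⟩
  · change e (map (R.cohPar x) (S.cohPar x) t) = (R.tensor S).cohPar x (e t)
    induction t using TensorProduct.induction_on with
    | zero => simp
    | add s t hs ht => simp only [map_add, hs, ht]
    | tmul m n =>
      obtain ⟨m, rfl⟩ := R.cls_surjective x m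
      obtain ⟨n, rfl⟩ := S.cls_surjective x n
      have hm := R.par_mem_ker x m.2
      have hn := S.par_mem_ker x n.2
      rw [map_tmul, cohPar_cls _ _ _ hm, cohPar_cls _ _ _ hn,
        he _ _ (hker hm hn), he _ _ (hker m.2 n.2),
        cohPar_cls _ _ _ ((R.tensor S).par_mem_ker x (hker m.2 n.2))]
      rfl
  · change e (tensorAct (R.ds x) (S.ds x) a t) =
      (R.tensor S).cohAct x a (e t)
    induction t using tensor_induction (R.ds x).par_par (S.ds x).par_par with
    | zero => simp
    | add s t hs ht => simp only [map_add, hs, ht]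
    | tmul k l m hm n hn =>
      rw [tensorAct_tmul _ _ ha hm]
      obtain ⟨m, hm', rfl⟩ := R.exists_homog_rep x hm
      obtain ⟨n, rfl⟩ := S.cls_surjective x n
      obtain ⟨a, ha', rfl⟩ := (adjoint g).exists_homog_rep x ha
      change e (R.cohAct x _ _ ⊗ₜ _ + _ • _ ⊗ₜ S.cohAct x _ _) = _
      have hm1 := R.act_mem_ker x a.2 m.2
      have hn1 := S.act_mem_ker x a.2 n.2
      rw [cohAct_cls, cohAct_cls, map_add, map_smul, he _ _ (hker hm1 n.2),
        he _ _ (hker m.2 hn1), he _ _ (hker m.2 n.2), cohAct_cls, ← map_smul, ← map_add]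
      refine congrArg _ (Subtype.ext ?_)
      exact (tensorAct_tmul R S ha' hm' (n : W)).symm

end SuperRep

/-- `(M ⊗ N)_x ≅ M_x ⊗ N_x`. -/
theorem SMod.tensor_DS (M N : SMod.{u, v} g) (x : SelfCommuting g) :
    Iso ((M.DS x).tensor (N.DS x)) ((M.tensor N).DS x) :=
  M.rep.exists_kunneth_isHom N.rep x

/-! ### The homomorphism `ds_x` on `K_g` -/

/-- `ds_x` on isomorphism classes. -/
def dsIsoClass (x : SelfCommuting g) : IsoClass.{u, v} g →* KRing.{u, v} (DSAlg x) where
  toFun := Quotient.lift (fun M : SMod.{u, v} g => KRing.cls (M.DS x))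
    (fun _ _ h => KRing.cls_eq_of_iso (SMod.Iso.DS h x))
  map_one' := (KRing.cls_eq_of_iso (SMod.unit_DS x)).trans KRing.cls_unit
  map_mul' := by
    rintro ⟨M⟩ ⟨N⟩
    exact (KRing.cls_eq_of_iso (SMod.tensor_DS M N x)).symm.trans (KRing.cls_tensor _ _)

/-- The free abelian group on the monoid of isomorphism classes is a monoid ring, so the
multiplicative map on classes extends to a ring homomorphism, which then has to kill two ideals.
Uniqueness holds because classes of modules generate additively. -/
theorem existsUnique_ds_KRing (x : SelfCommuting g) :
    ∃! ds : KRing.{u, v} g →+* KRing.{u, v} (DSAlg x),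
      ∀ M : SMod.{u, v} g, ds (KRing.cls M) = KRing.cls (M.DS x) := by
  let φ := FreeAbelianGroup.liftMonoid (dsIsoClass.{u, v} x)
  have hφ : ∀ M : SMod.{u, v} g, φ (gen M) = KRing.cls (M.DS x) := fun M =>
    FreeAbelianGroup.lift_apply_of _ _
  -- The ideal is the additive span of the exact relations, so no multiples of them need to be
  -- examined.
  have h1 : ∀ r ∈ exactIdeal.{u, v} g, φ r = 0 := by
    intro r hr
    change r ∈ AddSubgroup.closure _ at hr
    induction hr using AddSubgroup.closure_induction with
    | zero => exact map_zero φ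
    | add r s _ _ hr hs => rw [map_add, hr, hs, add_zero]
    | neg r _ hr => rw [map_neg, hr, neg_zero]
    | mem r hr =>
      obtain ⟨M₁, M₂, M₃, h, rfl⟩ := hr
      rw [map_add, map_sub, hφ, hφ, hφ, KRing.cls_DS_eq_add h x]
      abel
  let ψ := Ideal.Quotient.lift (exactIdeal.{u, v} g) φ h1
  have h2 : ∀ r ∈ parityIdeal.{u, v} g, ψ r = 0 := by
    intro r hr
    refine (Ideal.span_le (I := RingHom.ker ψ)).mpr ?_ hr
    rintro _ ⟨M, rfl⟩
    change ψ _ = 0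
    rw [map_add, Ideal.Quotient.lift_mk, Ideal.Quotient.lift_mk, hφ, hφ,
      KRing.cls_eq_of_iso (SMod.shift_DS M x), KRing.cls_shift, neg_add_cancel]
  refine ⟨Ideal.Quotient.lift (parityIdeal.{u, v} g) ψ h2, fun M => ?_, fun χ hχ => ?_⟩
  · rw [KRing.cls, Ideal.Quotient.lift_mk, Ideal.Quotient.lift_mk, hφ]
  · refine Ideal.Quotient.ringHom_ext (Ideal.Quotient.ringHom_ext (RingHom.ext fun r => ?_))
    refine DFunLike.congr_fun (F := FreeAbelianGroup (IsoClass.{u, v} g) →+ _)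
      (f := ((χ.comp (Ideal.Quotient.mk _)).comp (Ideal.Quotient.mk _)).toAddMonoidHom)
      (g := (((Ideal.Quotient.lift (parityIdeal.{u, v} g) ψ h2).comp
        (Ideal.Quotient.mk _)).comp (Ideal.Quotient.mk _)).toAddMonoidHom)
      (FreeAbelianGroup.lift_ext _ _ fun c => ?_) r
    obtain ⟨M⟩ := c
    exact (hχ M).trans (hφ M).symm

/-! ### Exponential evaluation on the group ring -/

/-- The ring homomorphism `ℤ[h^*] → ℂ⟦X⟧`, `e^μ ↦ exp (μ(a) X)`. -/
def expEval {h : Type*} [AddCommGroup h] [Module ℂ h] (a : h) :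
    AddMonoidAlgebra ℤ (Module.Dual ℂ h) →+* PowerSeries ℂ :=
  (AddMonoidAlgebra.lift ℤ (PowerSeries ℂ) (Module.Dual ℂ h)
    { toFun := fun μ => PowerSeries.rescale (μ.toAdd a) (PowerSeries.exp ℂ)
      map_one' := by simp
      map_mul' := fun μ ν => by
        rw [PowerSeries.exp_mul_exp_eq_exp_add]; rfl }).toRingHom

theorem expEval_single {h : Type*} [AddCommGroup h] [Module ℂ h] (a : h) (μ : Module.Dual ℂ h)
    (n : ℤ) : expEval a (.single μ n) = n • PowerSeries.rescale (μ a) (PowerSeries.exp ℂ) := by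
  change AddMonoidAlgebra.lift ℤ (PowerSeries ℂ) (Module.Dual ℂ h) _ _ = _
  rw [AddMonoidAlgebra.lift_single]; rfl

theorem coeff_expEval {h : Type*} [AddCommGroup h] [Module ℂ h] (a : h)
    (F : AddMonoidAlgebra ℤ (Module.Dual ℂ h)) (k : ℕ) :
    PowerSeries.coeff k (expEval a F) =
      (∑ μ ∈ F.coeff.support, (F.coeff μ : ℂ) * μ a ^ k) * (k.factorial : ℂ)⁻¹ := by
  change PowerSeries.coeff k (AddMonoidAlgebra.lift ℤ (PowerSeries ℂ) (Module.Dual ℂ h) _ F) = _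
  rw [AddMonoidAlgebra.lift_apply, Finsupp.sum, map_sum, Finset.sum_mul]
  refine Finset.sum_congr rfl fun μ _ => ?_
  simp [PowerSeries.coeff_rescale, PowerSeries.coeff_exp, mul_assoc]

/-- The exponential evaluations separate the elements of the group ring. -/
theorem eq_zero_of_expEval_eq_zero {h : Type*} [AddCommGroup h] [Module ℂ h]
    {F : AddMonoidAlgebra ℤ (Module.Dual ℂ h)} (hF : ∀ a, expEval a F = 0) : F = 0 := by
  classical
  -- A point off the finitely many hyperplanes `μ = ν`: the exponents occurring in `F` take distinct
  -- values at `a`.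
  obtain ⟨a, ha⟩ := Module.Dual.exists_forall_ne_zero_of_forall_exists
    (fun p : {p : F.coeff.support × F.coeff.support // p.1 ≠ p.2} =>
      (p.1.1 : Module.Dual ℂ h) - (p.1.2 : Module.Dual ℂ h)) (fun p => by
        by_contra! hp
        exact p.2 (Subtype.ext (sub_eq_zero.mp (LinearMap.ext hp))))
  have hpow : ∀ k, ∑ μ ∈ F.coeff.support, (F.coeff μ : ℂ) * μ a ^ k = 0 := fun k => by
    have := coeff_expEval a F k
    rw [hF a, map_zero] at this
    exact (mul_eq_zero.mp this.symm).resolve_right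
      (inv_ne_zero (Nat.cast_ne_zero.mpr k.factorial_ne_zero))
  have hpoly : ∀ P : Polynomial ℂ, ∑ μ ∈ F.coeff.support, (F.coeff μ : ℂ) * P.eval (μ a) = 0 := by
    intro P
    induction P using Polynomial.induction_on' with
    | add P Q hP hQ => simp [mul_add, Finset.sum_add_distrib, hP, hQ]
    | monomial n c =>
      have := congrArg (c * ·) (hpow n)
      simp only [mul_zero, Finset.mul_sum] at this
      rw [← this]
      refine Finset.sum_congr rfl fun μ _ => ?_
      rw [Polynomial.eval_monomial]; ring
  have hcoeff : F.coeff.support = ∅ := by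
    by_contra hne
    obtain ⟨μ, hμ⟩ := Finset.nonempty_iff_ne_empty.mpr hne
    -- A Lagrange polynomial: it vanishes at every exponent value except `μ a`, so it isolates the
    -- coefficient of `μ`.
    have h0 := hpoly (∏ ν ∈ F.coeff.support.erase μ, (Polynomial.X - Polynomial.C (ν a)))
    rw [Finset.sum_eq_single_of_mem μ hμ] at h0
    · rcases mul_eq_zero.mp h0 with h1 | h1
      · exact Finsupp.mem_support_iff.mp hμ (by exact_mod_cast h1)
      · rw [Polynomial.eval_prod, Finset.prod_eq_zero_iff] at h1
        obtain ⟨ν, hν, h2⟩ := h1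
        have hν' := Finset.mem_erase.mp hν
        refine ha ⟨(⟨μ, hμ⟩, ⟨ν, hν'.2⟩), fun h => hν'.1 (congrArg Subtype.val h).symm⟩ ?_
        simpa using h2
    · intro ν hν hne
      rw [Polynomial.eval_prod, Finset.prod_eq_zero (Finset.mem_erase.mpr ⟨hne, hν⟩) (by simp),
        mul_zero]
  have : F.coeff = 0 := Finsupp.support_eq_empty.mp hcoeff
  rw [← AddMonoidAlgebra.ofCoeff_coeff F, this, AddMonoidAlgebra.ofCoeff_zero]

theorem eq_of_expEval_eq {h : Type*} [AddCommGroup h] [Module ℂ h]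
    {F G : AddMonoidAlgebra ℤ (Module.Dual ℂ h)} (hF : ∀ a, expEval a F = expEval a G) :
    F = G :=
  sub_eq_zero.mp (eq_zero_of_expEval_eq_zero fun a => by rw [map_sub, hF, sub_self])

theorem expEval_restrictExp {h t : Type*} [AddCommGroup h] [Module ℂ h] [AddCommGroup t]
    [Module ℂ t] (ι : t →ₗ[ℂ] h) (a : t) (F : AddMonoidAlgebra ℤ (Module.Dual ℂ h)) :
    expEval a (restrictExp ι F) = expEval (ι a) F := by
  induction F using AddMonoidAlgebra.induction_linear with
  | zero => simp [restrictExp, AddMonoidAlgebra.mapDomain_zero]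
  | add F G hF hG =>
    have : restrictExp ι (F + G) = restrictExp ι F + restrictExp ι G :=
      AddMonoidAlgebra.mapDomain_add _ _ _
    rw [this, map_add, map_add, hF, hG]
  | single μ n =>
    rw [restrictExp, AddMonoidAlgebra.mapDomain_single, expEval_single, expEval_single]
    rfl

/-! ### Supertraces of powers -/

namespace SMod

/-- The supertrace `str_M (a^k)`. -/
def strPow (M : SMod.{u, v} g) (a : g) (k : ℕ) : ℂ :=
  LinearMap.trace ℂ M.carrier (M.rep.par * M.rep.act a ^ k)

/-- The generating series `str_M (exp (a X))`. -/
def strSeries (M : SMod.{u, v} g) (a : g) : PowerSeries ℂ :=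
  .mk fun k => M.strPow a k * (k.factorial : ℂ)⁻¹

theorem strSeries_eq_iff {h : Type*} [AddCommGroup h] [Module ℂ h]
    [LieSuperalgebra h] {M : SMod.{u, v} g} {N : SMod h} {a : g} {b : h} :
    M.strSeries a = N.strSeries b ↔ ∀ k, M.strPow a k = N.strPow b k := by
  refine ⟨fun hs k => ?_, fun hs => by ext k; simp [strSeries, hs]⟩
  have := congrArg (PowerSeries.coeff k) hs
  simp only [strSeries, PowerSeries.coeff_mk] at this
  exact mul_right_cancel₀ (inv_ne_zero (Nat.cast_ne_zero.mpr k.factorial_ne_zero)) this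

end SMod

/-- The involution is the difference of the projections to its two components, and the trace of a
projection is its rank. -/
theorem trace_eq_finrank_sub {V : Type*} [AddCommGroup V] [Module ℂ V] [FiniteDimensional ℂ V]
    {θ : V →ₗ[ℂ] V} (hθ : ∀ v, θ (θ v) = v) :
    LinearMap.trace ℂ V θ =
      (Module.finrank ℂ (homog θ 0) : ℂ) - Module.finrank ℂ (homog θ 1) := by
  have hp : ∀ i, LinearMap.IsProj (homog θ i) (proj θ i) := fun i =>
    ⟨fun v => proj_mem hθ i v, fun v hv => by rw [proj_of_mem hv, if_pos rfl]⟩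
  rw [← (hp 0).trace, ← (hp 1).trace, ← map_sub]
  congr 1
  ext v
  simp only [LinearMap.sub_apply, proj_apply, sgn_zero, sgn_one]
  module

/-- The parity involution preserves weight spaces. -/
theorem par_mem_genWeightSpace (h : LieSubalgebra ℂ (part g 0)) [LieRing.IsNilpotent h]
    (M : SMod.{u, v} g) (χ : h → ℂ) {m : M.carrier}
    (hm : m ∈ LieModule.genWeightSpace M.carrier χ) :
    M.rep.par m ∈ LieModule.genWeightSpace M.carrier χ := by
  rw [LieModule.mem_genWeightSpace] at hm ⊢
  intro a
  obtain ⟨k, hk⟩ := hm a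
  refine ⟨k, ?_⟩
  have hcomm : Commute (M.rep.par : Module.End ℂ M.carrier)
      (LieModule.toEnd ℂ h M.carrier a - χ a • 1) := by
    refine Commute.sub_right (LinearMap.ext fun n => ?_) ((Commute.one_right _).smul_right _)
    change M.rep.par (M.rep.act ((a : part g 0) : g) n) = M.rep.act ((a : part g 0) : g) _
    rw [M.rep.par_act, mem_homog.mp (a : part g 0).2, sgn_zero, one_smul]
  have := LinearMap.congr_fun (hcomm.pow_right k).eq m
  change M.rep.par (_ ) = _ at this
  exact this.symm.trans (by rw [hk, map_zero])

/-- Views the homogeneous part inside the weight space, so that its superdimension becomes the trace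
of the parity restricted there. -/
theorem finrank_weightPart (h : LieSubalgebra ℂ (part g 0)) [LieRing.IsNilpotent h]
    (M : SMod.{u, v} g) (μ : Module.Dual ℂ h) (i : ZMod 2) :
    Module.finrank ℂ (weightPart h M μ i) = Module.finrank ℂ (homog
      (M.rep.par.restrict (fun _ hm => par_mem_genWeightSpace h M μ hm) :
        (LieModule.genWeightSpace M.carrier (μ : h → ℂ)).toSubmodule →ₗ[ℂ] _) i) := by
  rw [← Submodule.finrank_map_subtype_eq]
  refine congrArg (fun S : Submodule ℂ M.carrier => Module.finrank ℂ S) ?_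
  ext m
  simp only [weightPart, Submodule.mem_inf, Submodule.mem_map, mem_homog]
  constructor
  · rintro ⟨h1, h2⟩
    exact ⟨⟨m, h1⟩, Subtype.ext h2, rfl⟩
  · rintro ⟨n, hn, rfl⟩
    exact ⟨n.2, congrArg Subtype.val hn⟩

/-- On a generalized weight space `a` is `χ(a)` plus a nilpotent operator commuting with the parity;
the nilpotent part does not contribute to the trace. -/
theorem strPow_eq_sum (h : LieSubalgebra ℂ (part g 0)) [LieRing.IsNilpotent h]
    (M : SMod.{u, v} g) (a : h) (k : ℕ) :
    M.strPow ((a : part g 0) : g) k =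
      ∑ χ : LieModule.Weight ℂ h M.carrier, (weightSdim h M χ.toLinear : ℂ) * χ a ^ k := by
  classical
  have hds := DirectSum.isInternal_submodule_of_iSupIndep_of_iSup_eq_top
    (LieSubmodule.iSupIndep_toSubmodule.mpr <| LieModule.iSupIndep_genWeightSpace' ℂ h M.carrier)
    (LieSubmodule.iSup_toSubmodule_eq_top.mpr <|
      LieModule.iSup_genWeightSpace_eq_top' ℂ h M.carrier)
  have hpow : ∀ (χ : LieModule.Weight ℂ h M.carrier) (k : ℕ),
      ∀ m ∈ (LieModule.genWeightSpace M.carrier χ).toSubmodule,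
      (M.rep.act ((a : part g 0) : g) ^ k) m ∈
        (LieModule.genWeightSpace M.carrier χ).toSubmodule := by
    intro χ k
    induction k with
    | zero => exact fun m hm => hm
    | succ k ih =>
      intro m hm
      rw [pow_succ]
      exact ih _ (LieSubmodule.lie_mem _ (x := a) hm)
  have hmaps : ∀ χ : LieModule.Weight ℂ h M.carrier,
      Set.MapsTo (M.rep.par * M.rep.act ((a : part g 0) : g) ^ k : Module.End ℂ M.carrier)
        (LieModule.genWeightSpace M.carrier χ).toSubmodule
        (LieModule.genWeightSpace M.carrier χ).toSubmodule :=
    fun χ m hm => par_mem_genWeightSpace h M χ (hpow χ k m hm)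
  rw [SMod.strPow, LinearMap.trace_eq_sum_trace_restrict hds hmaps]
  refine Finset.sum_congr rfl fun χ _ => ?_
  let W := LieModule.genWeightSpace M.carrier χ
  let θ : Module.End ℂ W := M.rep.par.restrict (fun _ hm => par_mem_genWeightSpace h M χ hm)
  let T : Module.End ℂ W := LieModule.toEnd ℂ h W a
  have hT : IsNilpotent (T - algebraMap ℂ _ (χ a)) :=
    LieModule.isNilpotent_toEnd_sub_algebraMap M.carrier χ a
  have hθT : Commute θ T := LinearMap.ext fun n => Subtype.ext (by
    change M.rep.par (M.rep.act ((a : part g 0) : g) n) = M.rep.act ((a : part g 0) : g) _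
    rw [M.rep.par_act, mem_homog.mp (a : part g 0).2, sgn_zero, one_smul]; rfl)
  -- Inductively, `θ T^k` commutes with the nilpotent operator `T - χ(a)`, so their product has
  -- trace zero.
  have key : ∀ k : ℕ, LinearMap.trace ℂ W (θ * T ^ k) = χ a ^ k * LinearMap.trace ℂ W θ := by
    intro k
    induction k with
    | zero => simp
    | succ k ih =>
      have := LinearMap.trace_comp_eq_mul_of_commute_of_isNilpotent (f := θ * T ^ k) (χ a)
        (hθT.mul_left ((Commute.refl T).pow_left k)) hT
      rw [ih] at this
      rw [pow_succ, ← mul_assoc, pow_succ, mul_comm (χ a ^ k), mul_assoc (χ a)]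
      exact this
  have hres : (M.rep.par * M.rep.act ((a : part g 0) : g) ^ k : Module.End ℂ M.carrier).restrict
      (hmaps χ) = θ * T ^ k := by
    have : ∀ (k : ℕ) (w : W), ((T ^ k) w : M.carrier) =
        (M.rep.act ((a : part g 0) : g) ^ k) (w : M.carrier) := by
      intro k
      induction k with
      | zero => exact fun _ => rfl
      | succ k ih => intro w; rw [pow_succ, pow_succ]; exact ih (T w)
    refine LinearMap.ext fun w => Subtype.ext ?_
    exact congrArg M.rep.par (this k w).symm
  have hθ : LinearMap.trace ℂ W θ = weightSdim h M χ.toLinear := by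
    rw [trace_eq_finrank_sub (fun w => Subtype.ext (M.rep.par_par w)), weightSdim,
      finrank_weightPart, finrank_weightPart]
    push_cast
    rfl
  rw [← hθ, mul_comm, ← key]
  exact congrArg _ hres

/-- The supercharacter determines and is determined by the supertraces. -/
theorem expEval_sch (h : LieSubalgebra ℂ (part g 0)) [LieRing.IsNilpotent h]
    (M : SMod.{u, v} g) (a : h) :
    expEval a (sch h M) = M.strSeries ((a : part g 0) : g) := by
  classical
  ext k
  rw [coeff_expEval, SMod.strSeries, PowerSeries.coeff_mk, strPow_eq_sum]
  congr 1
  have hinj : Function.Injective (fun χ : LieModule.Weight ℂ h M.carrier => χ.toLinear) :=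
    fun χ ψ hχ => LieModule.Weight.ext fun b => LinearMap.congr_fun hχ b
  refine Eq.trans ?_ (Finset.sum_image (s := Finset.univ)
    (g := fun χ : LieModule.Weight ℂ h M.carrier => χ.toLinear)
    (f := fun μ : Module.Dual ℂ h => (weightSdim h M μ : ℂ) * μ a ^ k) hinj.injOn)
  have hcoeff : ∀ μ, (sch h M).coeff μ = weightSdim h M μ := fun _ => rfl
  simp only [hcoeff]
  -- The support of `sch` can be smaller than the set of weights: weights of superdimension zero
  -- drop out.
  refine Finset.sum_subset (fun μ hμ => ?_) (fun μ _ hμ => ?_)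
  · rw [Finsupp.mem_support_iff, hcoeff] at hμ
    have hne : LieModule.genWeightSpace M.carrier (μ : h → ℂ) ≠ ⊥ := by
      intro hbot
      apply hμ
      have key : ∀ i, weightPart h M μ i = ⊥ := fun i => by
        rw [weightPart, hbot]; simp
      rw [weightSdim, key, key, sub_self]
    exact Finset.mem_image.mpr ⟨⟨μ, hne⟩, Finset.mem_univ _, rfl⟩
  · rw [Finsupp.mem_support_iff, not_not, hcoeff] at hμ
    rw [hμ, Int.cast_zero, zero_mul]

/-! ### Operations on modules and supertraces -/

namespace SMod

/-- The direct sum of two `g`-modules. -/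
def prod (M N : SMod.{u, v} g) : SMod.{u, v} g where
  carrier := M.carrier × N.carrier
  rep := .mk' (M.rep.par.prodMap N.rep.par)
    (fun m => Prod.ext (M.rep.par_par _) (N.rep.par_par _))
    { toFun := fun a => (M.rep.act a).prodMap (N.rep.act a)
      map_add' := fun a b => by ext <;> simp
      map_smul' := fun t a => by ext <;> simp }
    (fun a m => Prod.ext (M.rep.par_act a _) (N.rep.par_act a _))
    (fun ha hb m => Prod.ext (M.rep.act_br ha hb _) (N.rep.act_br ha hb _))

theorem strPow_prod (M N : SMod.{u, v} g) (a : g) (k : ℕ) :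
    (M.prod N).strPow a k = M.strPow a k + N.strPow a k := by
  have hpow : ∀ k : ℕ, (M.prod N).rep.act a ^ k =
      ((M.rep.act a ^ k).prodMap (N.rep.act a ^ k) :
        Module.End ℂ (M.carrier × N.carrier)) := by
    intro k
    induction k with
    | zero => rfl
    | succ k ih => rw [pow_succ, ih, pow_succ, pow_succ]; rfl
  rw [strPow, hpow]
  exact LinearMap.trace_prodMap' (M.rep.par * M.rep.act a ^ k) (N.rep.par * N.rep.act a ^ k)

theorem strPow_shift (M : SMod.{u, v} g) (a : g) (k : ℕ) :
    M.shift.strPow a k = -M.strPow a k := by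
  change LinearMap.trace ℂ M.carrier (-M.rep.par * M.rep.act a ^ k) = _
  rw [neg_mul, map_neg]; rfl

theorem strSeries_prod (M N : SMod.{u, v} g) (a : g) :
    (M.prod N).strSeries a = M.strSeries a + N.strSeries a := by
  ext k
  simp [strSeries, strPow_prod, add_mul]

theorem strSeries_shift (M : SMod.{u, v} g) (a : g) : M.shift.strSeries a = -M.strSeries a := by
  ext k
  simp [strSeries, strPow_shift]

theorem strSeries_unit (a : g) : (unit.{u, v} g).strSeries a = 1 := by
  have hone : LinearMap.trace ℂ (ULift.{v} ℂ) 1 = 1 := by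
    rw [LinearMap.trace_one, LinearEquiv.finrank_eq ULift.moduleEquiv]
    simp
  ext k
  rw [strSeries, PowerSeries.coeff_mk, PowerSeries.coeff_one]
  change LinearMap.trace ℂ (ULift.{v} ℂ) (1 * 0 ^ k) * _ = _
  split_ifs with hk
  · subst hk; rw [pow_zero, one_mul, hone]; simp
  · rw [zero_pow hk, mul_zero, map_zero, zero_mul]

/-- An even `a` acts by the sum of the commuting operators `a ⊗ 1` and `1 ⊗ a`; the binomial theorem
applies, and the trace is multiplicative on tensor products of operators. -/
theorem strPow_tensor (M N : SMod.{u, v} g) {a : g} (ha : a ∈ part g 0) (k : ℕ) :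
    (M.tensor N).strPow a k =
      ∑ p ∈ Finset.HasAntidiagonal.antidiagonal k,
        k.choose p.1 * (M.strPow a p.1 * N.strPow a p.2) := by
  have hact : (M.tensor N).rep.act a = (map (M.rep.act a) (1 : Module.End ℂ N.carrier) +
      map (1 : Module.End ℂ M.carrier) (N.rep.act a) :
        Module.End ℂ (M.carrier ⊗[ℂ] N.carrier)) := M.rep.tensor_act_even N.rep ha
  have hcomm : Commute (map (M.rep.act a) (1 : Module.End ℂ N.carrier) :
      Module.End ℂ (M.carrier ⊗[ℂ] N.carrier))
      (map (1 : Module.End ℂ M.carrier) (N.rep.act a)) := by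
    rw [Commute, SemiconjBy, ← TensorProduct.map_mul, ← TensorProduct.map_mul, mul_one, one_mul,
      mul_one, one_mul]
  have hpow := congrArg (fun T => LinearMap.trace ℂ (M.carrier ⊗[ℂ] N.carrier)
    ((map M.rep.par N.rep.par : Module.End ℂ (M.carrier ⊗[ℂ] N.carrier)) * T)) (hcomm.add_pow' k)
  rw [← hact] at hpow
  refine hpow.trans ?_
  rw [Finset.mul_sum, map_sum]
  refine Finset.sum_congr rfl fun p _ => ?_
  rw [mul_smul_comm, map_nsmul, nsmul_eq_mul, TensorProduct.map_pow, TensorProduct.map_pow,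
    one_pow, one_pow]
  congr 1
  rw [strPow, strPow, ← LinearMap.trace_tensorProduct', ← TensorProduct.map_mul, mul_one, one_mul]
  rw [← TensorProduct.map_mul]

/-- Dividing by `k!` turns the binomial convolution into the product of power series. -/
theorem strSeries_tensor (M N : SMod.{u, v} g) {a : g} (ha : a ∈ part g 0) :
    (M.tensor N).strSeries a = M.strSeries a * N.strSeries a := by
  ext k
  rw [PowerSeries.coeff_mul]
  simp only [strSeries, PowerSeries.coeff_mk]
  rw [strPow_tensor M N ha, Finset.sum_mul]
  refine Finset.sum_congr rfl fun p hp => ?_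
  obtain rfl := Finset.HasAntidiagonal.mem_antidiagonal.mp hp
  have h0 : ∀ n : ℕ, (n.factorial : ℂ) ≠ 0 := fun n => Nat.cast_ne_zero.mpr n.factorial_ne_zero
  have h1 : ((p.1 + p.2).choose p.1 : ℂ) * p.1.factorial * p.2.factorial =
      (p.1 + p.2).factorial := by
    rw [Nat.choose_symm_add]
    exact_mod_cast Nat.add_choose_mul_factorial_mul_factorial p.1 p.2
  field_simp [h0]
  rw [← h1]
  ring

end SMod

/-- An operator that anticommutes with a differential has the same trace on cohomology. -/
theorem SuperRep.trace_eq_trace_coh {V : Type v} [AddCommGroup V] [Module ℂ V]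
    [FiniteDimensional ℂ V] (R : SuperRep g V) (x : SelfCommuting g) (T : Module.End ℂ V)
    (hT : ∀ m, T (R.act x.elt m) = -R.act x.elt (T m)) (T' : Module.End ℂ (R.Coh x))
    (hT' : ∀ (m : LinearMap.ker (R.act x.elt)) (h : R.act x.elt (T m) = 0),
      T' (R.cls x m) = R.cls x ⟨T m, h⟩) :
    LinearMap.trace ℂ (R.Coh x) T' = LinearMap.trace ℂ V T := by
  obtain ⟨s, hs, -⟩ := R.exists_odd_pseudoInverse x
  obtain ⟨σ, hσ⟩ := (R.cls x).exists_rightInverse_of_surjective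
    (LinearMap.range_eq_top.mpr (R.cls_surjective x))
  replace hσ := LinearMap.congr_fun hσ
  let d := R.act x.elt
  let p := R.cohProj x s
  have hTker : ∀ m, d m = 0 → d (T m) = 0 := fun m hm => by
    have := hT m
    change T (d m) = -d (T m) at this
    rw [hm, map_zero] at this
    exact neg_eq_zero.mp this.symm
  let j : R.Coh x →ₗ[ℂ] V := (LinearMap.ker (R.act x.elt)).subtype ∘ₗ σ
  let q : V →ₗ[ℂ] R.Coh x := R.cls x ∘ₗ LinearMap.codRestrict _ p (R.act_cohProj x hs)
  have hqj : q ∘ₗ j = LinearMap.id := LinearMap.ext fun m =>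
    (R.cls_cohProj x hs (σ m)).trans (hσ m)
  -- `E` compares `T'`, transported to `V`, with `T` corrected by the homotopy `s`. It kills
  -- boundaries and takes values in boundaries, so its square is zero and its trace vanishes.
  let E : Module.End ℂ V := j ∘ₗ T' ∘ₗ q - T ∘ₗ p
  have hqd : ∀ m, q (d m) = 0 := fun m =>
    (congrArg (R.cls x) (Subtype.ext (R.cohProj_act x hs m))).trans (map_zero _)
  have hEd : ∀ m, E (d m) = 0 := fun m => by
    change j (T' (q (d m))) - T (p (d m)) = 0
    rw [hqd, R.cohProj_act x hs]
    simp
  have hE : ∀ m, ∃ n, E m = d n := fun m => by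
    have hp : d (p m) = 0 := R.act_cohProj x hs m
    have h1 : T' (q m) = R.cls x ⟨T (p m), hTker _ hp⟩ := hT' ⟨p m, hp⟩ _
    have h2 : R.cls x (σ (T' (q m)) - ⟨T (p m), hTker _ hp⟩) = 0 := by
      rw [map_sub, ← h1, sub_eq_zero]; exact hσ _
    obtain ⟨n, hn⟩ := (R.cls_eq_zero x).mp h2
    exact ⟨n, hn.symm⟩
  have hEE : E * E = 0 := LinearMap.ext fun m => by
    obtain ⟨n, hn⟩ := hE m
    change E (E m) = 0
    rw [hn, hEd]
  have hE0 : LinearMap.trace ℂ V E = 0 :=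
    (LinearMap.isNilpotent_trace_of_isNilpotent ⟨2, by rw [pow_two, hEE]⟩).eq_zero
  -- By cyclicity and anticommutation `tr(T s d) = tr(d T s) = -tr(T d s)`, so the two correction
  -- terms of `T p` cancel in the trace.
  have h1 : LinearMap.trace ℂ V (T ∘ₗ p) = LinearMap.trace ℂ V T := by
    have hTd : T * d = -(d * T) := LinearMap.ext hT
    have hp : T ∘ₗ p = T - T * d * s - T * s * d := by
      refine LinearMap.ext fun m => ?_
      change T (R.cohProj x s m) = _
      rw [cohProj_apply, map_sub, map_sub]; rfl
    rw [hp, map_sub, map_sub, LinearMap.trace_mul_comm ℂ (T * s) d, ← mul_assoc, hTd, neg_mul,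
      map_neg]
    ring
  have h2 : LinearMap.trace ℂ V (j ∘ₗ T' ∘ₗ q) = LinearMap.trace ℂ (R.Coh x) T' := by
    rw [LinearMap.trace_comp_comm' (T' ∘ₗ q) j, LinearMap.comp_assoc, hqj, LinearMap.comp_id]
  rw [← h1, ← h2, ← sub_eq_zero, ← map_sub]
  exact hE0

/-- The supertrace on `M_x` of the class of `c` is the supertrace of `c` on `M`. -/
theorem SMod.strPow_DS (M : SMod.{u, v} g) (x : SelfCommuting g)
    (c : LinearMap.ker ((SuperRep.adjoint g).act x.elt)) (hc : (c : g) ∈ part g 0) (k : ℕ) :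
    (M.DS x).strPow ((SuperRep.adjoint g).cls x c) k = M.strPow (c : g) k := by
  have hcx : ∀ m, M.rep.act (c : g) (M.rep.act x.elt m) =
      M.rep.act x.elt (M.rep.act (c : g) m) := fun m => by
    rw [M.rep.act_x_comm x c.2, mem_homog.mp hc, sgn_zero, one_smul]
  have hpow : ∀ (k : ℕ) m, (M.rep.act (c : g) ^ k) (M.rep.act x.elt m) =
      M.rep.act x.elt ((M.rep.act (c : g) ^ k) m) := by
    intro k
    induction k with
    | zero => exact fun _ => rfl
    | succ k ih =>
      intro m
      rw [pow_succ]
      change (M.rep.act (c : g) ^ k) (M.rep.act (c : g) _) = _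
      rw [hcx, ih]; rfl
  have hcoh : ∀ (k : ℕ) (m : LinearMap.ker (M.rep.act x.elt))
      (h : M.rep.act x.elt ((M.rep.act (c : g) ^ k) m) = 0),
      (M.rep.cohAct x ((SuperRep.adjoint g).cls x c) ^ k) (M.rep.cls x m) =
        M.rep.cls x ⟨(M.rep.act (c : g) ^ k) m, h⟩ := by
    intro k
    induction k with
    | zero => exact fun _ _ => rfl
    | succ k ih =>
      intro m h
      rw [pow_succ] at h
      rw [pow_succ]
      change (M.rep.cohAct x _ ^ k) (M.rep.cohAct x _ (M.rep.cls x m)) = _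
      rw [SuperRep.cohAct_cls, ih ⟨_, M.rep.act_mem_ker x c.2 m.2⟩ h]
      simp only [pow_succ]
      rfl
  have hker : ∀ m : LinearMap.ker (M.rep.act x.elt),
      M.rep.act x.elt ((M.rep.act (c : g) ^ k) m) = 0 := fun m => by
    rw [← hpow, LinearMap.mem_ker.mp m.2, map_zero]
  -- Powers of the even element `c` commute with `x` and the parity anticommutes with it, so their
  -- product anticommutes.
  refine M.rep.trace_eq_trace_coh x _ (fun m => ?_)
    (M.rep.cohPar x * M.rep.cohAct x ((SuperRep.adjoint g).cls x c) ^ k) (fun m h => ?_)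
  · change M.rep.par ((M.rep.act (c : g) ^ k) _) = -_
    rw [hpow, M.rep.par_x]; rfl
  · change M.rep.cohPar x ((M.rep.cohAct x _ ^ k) _) = _
    rw [hcoh k m (hker m)]
    rfl

/-! ### Supercharacter rings -/

section JRing

variable (h : LieSubalgebra ℂ (part g 0)) [LieRing.IsNilpotent h]

theorem sch_eq_iff {M N : SMod.{u, v} g} :
    sch h M = sch h N ↔
      ∀ a : h, M.strSeries ((a : part g 0) : g) = N.strSeries ((a : part g 0) : g) := by
  refine ⟨fun hs a => ?_, fun hs => eq_of_expEval_eq fun a => ?_⟩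
  · rw [← expEval_sch, hs, expEval_sch]
  · rw [expEval_sch, expEval_sch, hs]

theorem sch_eq_of_iso {M N : SMod.{u, v} g} (e : SMod.Iso M N) : sch h M = sch h N := by
  obtain ⟨e, he⟩ := e
  rw [sch_eq_iff]
  intro a
  rw [SMod.strSeries_eq_iff]
  intro k
  rw [SMod.strPow, SMod.strPow, ← LinearMap.trace_conj' _ e]
  congr 1
  have hpow : ∀ (k : ℕ) m, e ((M.rep.act ((a : part g 0) : g) ^ k) m) =
      (N.rep.act ((a : part g 0) : g) ^ k) (e m) := by
    intro k
    induction k with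
    | zero => exact fun _ => rfl
    | succ k ih =>
      intro m
      rw [pow_succ, pow_succ]
      exact (ih _).trans (congrArg _ (he.map_act _ m))
  refine LinearMap.ext fun n => ?_
  obtain ⟨m, rfl⟩ := e.surjective n
  rw [LinearEquiv.conj_apply_apply, e.symm_apply_apply]
  exact (he.map_par _).trans (congrArg N.rep.par (hpow k m))

theorem sch_prod (M N : SMod.{u, v} g) : sch h (M.prod N) = sch h M + sch h N :=
  eq_of_expEval_eq fun a => by
    rw [map_add, expEval_sch, expEval_sch, expEval_sch, SMod.strSeries_prod]

theorem sch_shift (M : SMod.{u, v} g) : sch h M.shift = -sch h M :=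
  eq_of_expEval_eq fun a => by rw [map_neg, expEval_sch, expEval_sch, SMod.strSeries_shift]

theorem sch_tensor (M N : SMod.{u, v} g) : sch h (M.tensor N) = sch h M * sch h N :=
  eq_of_expEval_eq fun a => by
    rw [map_mul, expEval_sch, expEval_sch, expEval_sch, SMod.strSeries_tensor _ _ (Subtype.prop _)]

theorem sch_unit : sch h (SMod.unit.{u, v} g) = 1 :=
  eq_of_expEval_eq fun a => by rw [map_one, expEval_sch, SMod.strSeries_unit]

/-- The supercharacter ring consists of the supercharacters of finite-dimensional modules. -/
theorem coe_JRing :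
    (JRing.{u, v} h : Set (AddMonoidAlgebra ℤ (Module.Dual ℂ h))) = Set.range (sch.{u, v} h) := by
  -- Supercharacters are already closed under all ring operations: parity shift gives negatives, and
  -- `1 ⊕ Π1` has supercharacter zero.
  let S : Subring (AddMonoidAlgebra ℤ (Module.Dual ℂ h)) :=
    { carrier := Set.range (sch.{u, v} h)
      mul_mem' := by rintro _ _ ⟨M, rfl⟩ ⟨N, rfl⟩; exact ⟨_, sch_tensor h M N⟩
      one_mem' := ⟨_, sch_unit h⟩
      add_mem' := by rintro _ _ ⟨M, rfl⟩ ⟨N, rfl⟩; exact ⟨_, sch_prod h M N⟩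
      zero_mem' := ⟨(SMod.unit g).prod (SMod.unit g).shift, by
        rw [sch_prod, sch_shift, add_neg_cancel]⟩
      neg_mem' := by rintro _ ⟨M, rfl⟩; exact ⟨_, sch_shift h M⟩ }
  exact Set.Subset.antisymm (Subring.closure_le (t := S).mpr le_rfl) Subring.subset_closure

end JRing

/-! ### Invariant functions are determined by their restriction to a Cartan subalgebra -/

section Conjugation

open NormedSpace

theorem hasSum_exp_apply {E : Type*} [NormedAddCommGroup E] [NormedSpace ℂ E] [CompleteSpace E]
    (T : E →L[ℂ] E) (y : E) :
    HasSum (fun n : ℕ => (n.factorial : ℂ)⁻¹ • (T ^ n) y) (exp T y) := by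
  have h := (NormedSpace.exp_series_hasSum_exp' (𝕂 := ℂ) T).mapL (ContinuousLinearMap.apply ℂ E y)
  simpa only [ContinuousLinearMap.apply_apply, smul_apply] using h

variable {A : Type*} [NormedRing A] [NormedAlgebra ℂ A] [CompleteSpace A]

/-- Left and right multiplication by `x` commute, so the exponential of their difference factors
into multiplication by `exp x` on the left and by `exp (-x)` on the right. -/
theorem exp_mul_left_sub_mul_right (x y : A) :
    exp (ContinuousLinearMap.mul ℂ A x - (ContinuousLinearMap.mul ℂ A).flip x) y =
      exp x * y * exp (-x) := by
  set l := ContinuousLinearMap.mul ℂ A x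
  set r := (ContinuousLinearMap.mul ℂ A).flip x
  have hl : ∀ (n : ℕ) z, (l ^ n) z = x ^ n * z := by
    intro n
    induction n with
    | zero => simp
    | succ n ih => intro z; rw [pow_succ, pow_succ, mul_assoc]; exact ih (x * z)
  have hr : ∀ (n : ℕ) z, ((-r) ^ n) z = z * (-x) ^ n := by
    intro n
    induction n with
    | zero => simp
    | succ n ih =>
      intro z
      rw [pow_succ, pow_succ', ← mul_assoc]
      refine (ih (-(z * x))).trans ?_
      rw [mul_neg]
  have hexpl : ∀ z, exp l z = exp x * z := fun z => by
    refine (hasSum_exp_apply l z).unique ?_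
    have := (NormedSpace.exp_series_hasSum_exp' (𝕂 := ℂ) x).mul_right z
    simpa only [hl, smul_mul_assoc] using this
  have hexpr : ∀ z, exp (-r) z = z * exp (-x) := fun z => by
    refine (hasSum_exp_apply (-r) z).unique ?_
    have := (NormedSpace.exp_series_hasSum_exp' (𝕂 := ℂ) (-x)).mul_left z
    simpa only [hr, mul_smul_comm] using this
  have hcomm : Commute l (-r) := by
    refine Commute.neg_right (ContinuousLinearMap.ext fun z => ?_)
    change x * (z * x) = x * z * x
    rw [mul_assoc]
  let _ : NormedAlgebra ℚ (A →L[ℂ] A) := .restrictScalars ℚ ℂ _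
  rw [sub_eq_add_neg, NormedSpace.exp_add_of_commute hcomm]
  change exp l (exp (-r) y) = _
  rw [hexpl, hexpr, mul_assoc]

open Filter Topology in
/-- Let `i` be a representation by operators of a space `E` with a bracket `B`, and `j : H → E` a
linear map such that `E = j(H) + B(E, j(y₀))` for some `y₀`. If `τ(θ i(a)^k)` vanishes for
`a ∈ j(H)`, then it vanishes for all `a`, when `τ` is a trace and `θ` commutes with `i(E)`. -/
theorem trace_pow_eq_zero_of_regular_normed {E H : Type*} [NormedAddCommGroup E] [NormedSpace ℂ E]
    [FiniteDimensional ℂ E] [NormedAddCommGroup H] [NormedSpace ℂ H] [FiniteDimensional ℂ H]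
    [FiniteDimensional ℂ A] (τ : A →ₗ[ℂ] ℂ) (hτ : ∀ u w, τ (u * w) = τ (w * u)) (θ : A)
    (i : E →ₗ[ℂ] A) (B : E →ₗ[ℂ] E →ₗ[ℂ] E) (hB : ∀ x y, i (B x y) = i x * i y - i y * i x)
    (hθ : ∀ x, Commute θ (i x)) (j : H →ₗ[ℂ] E) (y₀ : H)
    (hreg : ∀ a, ∃ y x, a = j y + B x (j y₀)) (k : ℕ)
    (h0 : ∀ y, τ (θ * i (j y) ^ k) = 0) (a : E) : τ (θ * i a ^ k) = 0 := by
  have : CompleteSpace E := FiniteDimensional.complete ℂ E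
  have : CompleteSpace H := FiniteDimensional.complete ℂ H
  let ad : E →L[ℂ] E →L[ℂ] E :=
    LinearMap.toContinuousLinearMap (LinearMap.toContinuousLinearMap.toLinearMap ∘ₗ B)
  let i' : E →L[ℂ] A := LinearMap.toContinuousLinearMap i
  let j' : H →L[ℂ] E := LinearMap.toContinuousLinearMap j
  -- The representation carries `ad x` to the commutator with `i x`, hence `exp (ad x)` to
  -- conjugation by `exp (i x)`.
  have hexp : ∀ x y, i (exp (ad x) y) = exp (i x) * i y * exp (-i x) := by
    intro x y
    rw [← exp_mul_left_sub_mul_right]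
    have hpow : ∀ (n : ℕ) (y : E), i (((ad x) ^ n) y) =
        ((ContinuousLinearMap.mul ℂ A (i x) - (ContinuousLinearMap.mul ℂ A).flip (i x)) ^ n)
          (i y) := by
      intro n
      induction n with
      | zero => exact fun _ => rfl
      | succ n ih =>
        intro y
        rw [pow_succ, pow_succ]
        exact (ih (B x y)).trans (congrArg _ (hB x y))
    have h1 := (hasSum_exp_apply (ad x) y).mapL i'
    have h2 := hasSum_exp_apply
      (ContinuousLinearMap.mul ℂ A (i x) - (ContinuousLinearMap.mul ℂ A).flip (i x)) (i y)
    have hfun : ∀ n : ℕ, i' ((n.factorial : ℂ)⁻¹ • ((ad x) ^ n) y) = (n.factorial : ℂ)⁻¹ •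
        ((ContinuousLinearMap.mul ℂ A (i x) - (ContinuousLinearMap.mul ℂ A).flip (i x)) ^ n)
          (i y) := fun n => by
      rw [map_smul, ← hpow]; rfl
    simp only [hfun] at h1
    exact h1.unique h2
  -- The image of `Φ` consists of the conjugates of `j(H)`. Its derivative at `(y₀, 0)` is `(y, x) ↦
  -- j y + B x (j y₀)`, surjective by `hreg`, so the image contains a neighbourhood of `j y₀`.
  let Φ : H × E → E := fun p => exp (ad p.2) (j' p.1)
  have hΦ0 : Φ (y₀, 0) = j y₀ := by simp [Φ, j']
  let _ : NormedAlgebra ℚ A := .restrictScalars ℚ ℂ _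
  -- The conjugating element commutes with `θ` and cancels with its inverse by cyclicity of `τ`.
  have hΦτ : ∀ p, τ (θ * i (Φ p) ^ k) = 0 := by
    rintro ⟨y, x⟩
    change τ (θ * i (exp (ad x) (j y)) ^ k) = 0
    rw [hexp]
    have hinv : exp (-i x) * exp (i x) = 1 := by
      rw [← NormedSpace.exp_add_of_commute (Commute.refl (i x)).neg_left, neg_add_cancel,
        NormedSpace.exp_zero]
    have hinv' : exp (i x) * exp (-i x) = 1 := by
      rw [← NormedSpace.exp_add_of_commute (Commute.refl (i x)).neg_right, add_neg_cancel,
        NormedSpace.exp_zero]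
    have hconj : ∀ k : ℕ, (exp (i x) * i (j y) * exp (-i x)) ^ k * exp (i x) =
        exp (i x) * i (j y) ^ k := by
      intro k
      induction k with
      | zero => simp
      | succ k ih =>
        rw [pow_succ, mul_assoc, mul_assoc _ (exp (-i x)), hinv, mul_one, ← mul_assoc, ih,
          mul_assoc, ← pow_succ]
    have h1 : (exp (i x) * i (j y) * exp (-i x)) ^ k = exp (i x) * i (j y) ^ k * exp (-i x) := by
      rw [← hconj, mul_assoc (_ ^ k), hinv', mul_one]
    have hcomm : Commute θ (exp (i x)) := (hθ x).exp_right
    rw [h1, ← mul_assoc, ← mul_assoc, hcomm.eq, hτ, ← mul_assoc, ← mul_assoc, hinv, one_mul]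
    exact h0 y
  have hderiv : HasStrictFDerivAt Φ
      (j'.comp (ContinuousLinearMap.fst ℂ H E) +
        (ad.comp (ContinuousLinearMap.snd ℂ H E)).flip (j' y₀)) (y₀, 0) := by
    have h1 : HasStrictFDerivAt (fun p : H × E => exp (ad p.2))
        (ad.comp (ContinuousLinearMap.snd ℂ H E)) (y₀, 0) := by
      have h2 : HasStrictFDerivAt (exp : (E →L[ℂ] E) → (E →L[ℂ] E))
          (1 : (E →L[ℂ] E) →L[ℂ] (E →L[ℂ] E))
          ((ad.comp (ContinuousLinearMap.snd ℂ H E)) (y₀, 0)) := by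
        have : (ad.comp (ContinuousLinearMap.snd ℂ H E)) (y₀, 0) = 0 := by simp
        rw [this]
        exact hasStrictFDerivAt_exp_zero
      exact h2.comp (y₀, 0) (ad.comp (ContinuousLinearMap.snd ℂ H E)).hasStrictFDerivAt
    have h3 : HasStrictFDerivAt (fun p : H × E => j' p.1)
        (j'.comp (ContinuousLinearMap.fst ℂ H E)) (y₀, 0) :=
      (j'.comp (ContinuousLinearMap.fst ℂ H E)).hasStrictFDerivAt
    refine (h1.clm_apply h3).congr_fderiv ?_
    ext p <;> simp
  have hsurj := hderiv.map_nhds_eq_of_surj (by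
    rw [LinearMap.range_eq_top]
    intro b
    obtain ⟨y, x, hb⟩ := hreg b
    exact ⟨(y, x), hb.symm⟩)
  rw [hΦ0] at hsurj
  have hev : ∀ᶠ b in 𝓝 (j y₀), τ (θ * i b ^ k) = 0 := by
    rw [← hsurj, eventually_map]
    exact Eventually.of_forall hΦτ
  -- The function on the complex line from `j y₀` (at `s = 0`) to `a` (at `s = 1`). It is entire and
  -- vanishes near `0`, so the identity theorem gives its vanishing at `1`.
  let F : ℂ → ℂ := fun s => LinearMap.toContinuousLinearMap τ
    (θ * (i' (j y₀) + s • i' (a - j y₀)) ^ k)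
  have hF : Differentiable ℂ F := by
    unfold F
    fun_prop
  have hF0 : ∀ᶠ s in 𝓝 (0 : ℂ), F s = 0 := by
    have hcont : Tendsto (fun s : ℂ => j y₀ + s • (a - j y₀)) (𝓝 0) (𝓝 (j y₀)) := by
      have : Continuous (fun s : ℂ => j y₀ + s • (a - j y₀)) := by fun_prop
      simpa using this.tendsto 0
    refine (hcont.eventually hev).mono fun s hs => ?_
    rw [map_add, map_smul] at hs
    exact hs
  have hzero := AnalyticOnNhd.eq_of_eventuallyEq (f := F) (g := 0)
    (fun s _ => hF.analyticAt s) (fun s _ => analyticAt_const) hF0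
  have := congrFun hzero 1
  simpa [F, i'] using this

end Conjugation

section

attribute [local instance] Matrix.linftyOpNormedRing Matrix.linftyOpNormedAlgebra

/-- The version of `trace_pow_eq_zero_of_regular_normed` for operators on a vector space. -/
theorem trace_pow_eq_zero_of_regular {V E H : Type*} [AddCommGroup V] [Module ℂ V]
    [FiniteDimensional ℂ V] [AddCommGroup E] [Module ℂ E]
    [FiniteDimensional ℂ E] [AddCommGroup H] [Module ℂ H] [FiniteDimensional ℂ H]
    (θ : Module.End ℂ V) (ρ : E →ₗ[ℂ] Module.End ℂ V) (B : E →ₗ[ℂ] E →ₗ[ℂ] E)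
    (hB : ∀ x y, ρ (B x y) = ρ x * ρ y - ρ y * ρ x)
    (hθ : ∀ x, Commute θ (ρ x)) (j : H →ₗ[ℂ] E) (y₀ : H)
    (hreg : ∀ a, ∃ y x, a = j y + B x (j y₀)) (k : ℕ)
    (h0 : ∀ y, LinearMap.trace ℂ V (θ * ρ (j y) ^ k) = 0) (a : E) :
    LinearMap.trace ℂ V (θ * ρ a ^ k) = 0 := by
  -- Bases transport everything to coordinate spaces and matrices, which carry complete norms.
  let b := Module.finBasis ℂ V
  let φ := LinearMap.toMatrixAlgEquiv b
  let e := (Module.finBasis ℂ E).equivFun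
  let f := (Module.finBasis ℂ H).equivFun
  have htr : ∀ T : Module.End ℂ V, (φ T).trace = LinearMap.trace ℂ V T := fun T =>
    (LinearMap.trace_eq_matrix_trace ℂ b T).symm
  have hpow : ∀ x, φ θ * φ (ρ x) ^ k = φ (θ * ρ x ^ k) := fun x => by rw [map_mul, map_pow]
  have key := trace_pow_eq_zero_of_regular_normed (Matrix.traceLinearMap (Fin _) ℂ ℂ)
    (fun u w => Matrix.trace_mul_comm u w) (φ θ)
    (φ.toLinearMap ∘ₗ ρ ∘ₗ e.symm.toLinearMap)
    ((LinearMap.compr₂ B e.toLinearMap).compl₁₂ e.symm.toLinearMap e.symm.toLinearMap)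
    (fun x y => by simp [hB])
    (fun x => (hθ (e.symm x)).map φ)
    (e.toLinearMap ∘ₗ j ∘ₗ f.symm.toLinearMap) (f y₀)
    (fun a => by
      obtain ⟨y, x, h⟩ := hreg (e.symm a)
      refine ⟨f y, e x, ?_⟩
      rw [e.symm_apply_eq] at h
      simp [h])
    k (fun y => by
      have := h0 (f.symm y)
      rw [← htr, ← hpow] at this
      simpa using this) (e a)
  rw [← htr, ← hpow]
  simpa using key

end

/-! ### Regular elements of a Cartan subalgebra -/

/-- Take `y₀` in the Cartan subalgebra outside the kernels of all nonzero roots. On each nonzero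
root space `ad y₀` is a nonzero scalar plus a nilpotent, hence invertible, so `[y₀, L]` contains all
these root spaces, and together with `h` they span `L`. -/
theorem exists_regular {L : Type*} [LieRing L] [LieAlgebra ℂ L] [FiniteDimensional ℂ L]
    (h : LieSubalgebra ℂ L) [h.IsCartanSubalgebra] :
    ∃ y₀ : h, ∀ a : L, ∃ (y : h) (x : L), a = (y : L) + ⁅x, (y₀ : L)⁆ := by
  obtain ⟨y₀, hy₀⟩ := Module.Dual.exists_forall_ne_zero_of_forall_exists
    (fun α : {α : LieModule.Weight ℂ h L // α.IsNonZero} => α.1.toLinear) (fun α => by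
      by_contra! hα
      exact α.2 (funext hα))
  refine ⟨y₀, fun a => ?_⟩
  let S : Submodule ℂ L := h.toSubmodule ⊔ LinearMap.range (LieModule.toEnd ℂ h L y₀)
  have htop : S = ⊤ := by
    have h1 := congrArg LieSubmodule.toSubmodule
      (LieAlgebra.cartan_sup_iSup_rootSpace_eq_top (K := ℂ) (L := L) (H := h))
    simp only [LieSubmodule.sup_toSubmodule, LieSubmodule.iSup_toSubmodule,
      LieSubmodule.top_toSubmodule] at h1
    rw [eq_top_iff, ← h1]
    refine sup_le le_sup_left (iSup₂_le fun α hα => le_sup_of_le_right fun m hm => ?_)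
    let W := LieModule.genWeightSpace L (α : h → ℂ)
    have hnil := LieModule.isNilpotent_toEnd_sub_algebraMap L (α : h → ℂ) y₀
    have hunit : IsUnit (LieModule.toEnd ℂ h W y₀) := by
      have hα0 : α y₀ ≠ 0 := hy₀ ⟨α, hα⟩
      have := hnil.isUnit_add_right_of_commute
        ((IsUnit.mk0 _ hα0).map (algebraMap ℂ (Module.End ℂ W)))
        (Algebra.commutes (α y₀) _).symm
      exact (congrArg IsUnit (sub_add_cancel _ _)).mp this
    obtain ⟨n, hn⟩ := ((Module.End.isUnit_iff _).mp hunit).surjective ⟨m, hm⟩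
    exact ⟨n, congrArg Subtype.val hn⟩
  obtain ⟨y, hy, _, ⟨x, rfl⟩, hxy⟩ := Submodule.mem_sup.mp (htop ▸ Submodule.mem_top : a ∈ S)
  -- The sign accounts for `⁅y₀, x⁆ = ⁅-x, y₀⁆`.
  refine ⟨⟨y, hy⟩, -x, ?_⟩
  rw [← hxy, neg_lie, lie_skew]
  rfl

/-- Supertraces on the even part are determined by the supercharacter. -/
theorem strSeries_eq_of_sch_eq [FiniteDimensional ℂ g] (h : LieSubalgebra ℂ (part g 0))
    [h.IsCartanSubalgebra] {M N : SMod.{u, v} g} (hMN : sch h M = sch h N) {a : g}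
    (ha : a ∈ part g 0) : M.strSeries a = N.strSeries a := by
  obtain ⟨y₀, hy₀⟩ := exists_regular h
  -- The supertraces of `M ⊕ ΠN` are the differences of those of `M` and `N`, so equality becomes
  -- the vanishing of a single invariant function.
  let P := M.prod N.shift
  have hP : ∀ (a : g) (k : ℕ), P.strPow a k = M.strPow a k - N.strPow a k := fun a k => by
    rw [SMod.strPow_prod, SMod.strPow_shift, sub_eq_add_neg]
  rw [SMod.strSeries_eq_iff]
  intro k
  rw [← sub_eq_zero, ← hP]
  refine trace_pow_eq_zero_of_regular P.rep.par (P.rep.act ∘ₗ (part g 0).subtype)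
    (LinearMap.mk₂ ℂ (fun x y => ⁅x, y⁆) add_lie smul_lie lie_add (fun c x y => lie_smul c x y))
    (fun x y => ?_) (fun x => ?_) h.toSubmodule.subtype y₀ (fun a => ?_) k (fun y => ?_) ⟨a, ha⟩
  · refine LinearMap.ext fun m => ?_
    refine (P.rep.act_br x.2 y.2 m).trans ?_
    rw [mul_zero, sgn_zero, one_smul]
    rfl
  · refine LinearMap.ext fun m => ?_
    change P.rep.par (P.rep.act (x : g) m) = P.rep.act (x : g) _
    rw [P.rep.par_act, mem_homog.mp x.2, sgn_zero, one_smul]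
  · exact hy₀ a
  · refine (hP _ k).trans ?_
    rw [sub_eq_zero]
    exact SMod.strSeries_eq_iff.mp ((sch_eq_iff h).mp hMN y) k

/-! ### The homomorphism `ds_x` on supercharacter rings -/

section

variable {x : SelfCommuting g}

/-- Each even element of `g_x` has an even representative. -/
theorem exists_even_rep {a : DSAlg x} (ha : a ∈ part (DSAlg x) 0) :
    ∃ c : LinearMap.ker ((SuperRep.adjoint g).act x.elt),
      (c : g) ∈ part g 0 ∧ (SuperRep.adjoint g).cls x c = a :=
  (SuperRep.adjoint g).exists_homog_rep x ha

theorem SMod.strSeries_DS (M : SMod.{u, v} g)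
    (c : LinearMap.ker ((SuperRep.adjoint g).act x.elt)) (hc : (c : g) ∈ part g 0) :
    (M.DS x).strSeries ((SuperRep.adjoint g).cls x c) = M.strSeries (c : g) :=
  SMod.strSeries_eq_iff.mpr (M.strPow_DS x c hc)

variable (t : LieSubalgebra ℂ (part (DSAlg x) 0)) [LieRing.IsNilpotent t]

/-- Well-definedness of `ds_x` on supercharacters. The lift `c` of an element of `t` may lie outside
`h`, which is why supertraces on all of `g_0` must be controlled. -/
theorem sch_DS_eq_of_sch_eq [FiniteDimensional ℂ g] (h : LieSubalgebra ℂ (part g 0))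
    [h.IsCartanSubalgebra] {M N : SMod.{u, v} g} (hMN : sch h M = sch h N) :
    sch t (M.DS x) = sch t (N.DS x) := by
  rw [sch_eq_iff]
  intro a
  obtain ⟨c, hc, hca⟩ := exists_even_rep (a : part (DSAlg x) 0).2
  rw [← hca, SMod.strSeries_DS _ c hc, SMod.strSeries_DS _ c hc]
  exact strSeries_eq_of_sch_eq h hMN hc

/-- Both sides are compared through supertraces on the original modules, which makes an isomorphism
between `(M ⊕ N)_x` and `M_x ⊕ N_x` unnecessary. -/
theorem sch_DS_prod (M N : SMod.{u, v} g) :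
    sch t ((M.prod N).DS x) = sch t (M.DS x) + sch t (N.DS x) := by
  rw [← sch_prod, sch_eq_iff]
  intro a
  obtain ⟨c, hc, hca⟩ := exists_even_rep (a : part (DSAlg x) 0).2
  rw [← hca, SMod.strSeries_prod, SMod.strSeries_DS _ c hc, SMod.strSeries_DS _ c hc,
    SMod.strSeries_DS _ c hc, SMod.strSeries_prod]

theorem sch_DS_tensor (M N : SMod.{u, v} g) :
    sch t ((M.tensor N).DS x) = sch t (M.DS x) * sch t (N.DS x) := by
  rw [← sch_tensor]
  exact (sch_eq_of_iso t (SMod.tensor_DS M N x)).symm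

theorem sch_DS_unit : sch t ((SMod.unit.{u, v} g).DS x) = 1 := by
  rw [← sch_unit.{u, v} t]
  exact sch_eq_of_iso t (SMod.unit_DS x)

/-- Every element of the source is the supercharacter of some module, so `ds_x` is defined by
choosing one; the result is independent of the choice, and each ring operation is checked on a
module realizing it. This surjectivity of `sch` also gives uniqueness. -/
theorem existsUnique_ds_JRing [FiniteDimensional ℂ g] (h : LieSubalgebra ℂ (part g 0))
    [h.IsCartanSubalgebra] :
    ∃! ds : JRing.{u, v} h →+* JRing.{u, v} t,
      ∀ M : SMod.{u, v} g, ds (JRing.cls h M) = JRing.cls t (M.DS x) := by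
  have hrep : ∀ F : JRing.{u, v} h, ∃ M : SMod.{u, v} g, sch h M = F := fun F => by
    have := F.2
    rw [← SetLike.mem_coe, coe_JRing] at this
    exact this
  choose rep hrep using hrep
  let f : JRing.{u, v} h → JRing.{u, v} t := fun F => JRing.cls t ((rep F).DS x)
  have hf : ∀ (F : JRing.{u, v} h) (M : SMod.{u, v} g), sch h M = F →
      f F = JRing.cls t (M.DS x) := fun F M hM =>
    Subtype.ext (sch_DS_eq_of_sch_eq t h ((hrep F).trans hM.symm))
  refine ⟨RingHom.mk' ⟨⟨f, ?_⟩, fun F G => ?_⟩ fun F G => ?_, fun M => hf _ M rfl,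
    fun χ hχ => RingHom.ext fun F => ?_⟩
  · exact (hf 1 (SMod.unit g) (sch_unit h)).trans (Subtype.ext (sch_DS_unit t))
  · refine (hf (F * G) ((rep F).tensor (rep G)) ?_).trans (Subtype.ext (sch_DS_tensor t _ _))
    rw [sch_tensor, hrep, hrep]; rfl
  · refine (hf (F + G) ((rep F).prod (rep G)) ?_).trans (Subtype.ext (sch_DS_prod t _ _))
    rw [sch_prod, hrep, hrep]; rfl
  · have hF : F = JRing.cls h (rep F) := Subtype.ext (hrep F).symm
    exact (congrArg χ hF).trans ((hχ _).trans (hf F (rep F) (hrep F)).symm)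

/-- If `t` is embedded in `h`, then `ds_x` is the restriction of supercharacters. -/
theorem sch_DS_eq_restrictExp (h : LieSubalgebra ℂ (part g 0)) [LieRing.IsNilpotent h]
    (ι : t →ₗ[ℂ] h) (hι : IsEmbeddingInto ι) (M : SMod.{u, v} g) :
    sch t (M.DS x) = restrictExp ι (sch h M) := by
  refine eq_of_expEval_eq fun a => ?_
  obtain ⟨c, hc, hca⟩ := hι a
  -- Evaluated at `a`, both sides are supertrace series: of the class of `c` on `M_x`, and of its
  -- representative `c = ι a` on `M`.
  rw [expEval_restrictExp, expEval_sch, expEval_sch, ← hca, ← hc]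
  exact M.strSeries_DS c (hc ▸ (ι a : part g 0).2)

end

end Super

end

/-! ### The homomorphisms `ds_x` on both rings and the restriction formula -/

theorem mainTheorem1 {g : Type u} [AddCommGroup g] [Module ℂ g] [FiniteDimensional ℂ g]
    [Super.LieSuperalgebra g] (h : LieSubalgebra ℂ (Super.part g 0)) [h.IsCartanSubalgebra]
    (_hg : Super.ContragredientData h) (x : Super.SelfCommuting g) (_hx : x.elt ≠ 0) :
    (∃! ds : Super.KRing.{u, v} g →+* Super.KRing.{u, v} (Super.DSAlg x),
      ∀ M : Super.SMod.{u, v} g, ds (Super.KRing.cls M) = Super.KRing.cls (M.DS x)) ∧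
    (Super.JRing.{u, v} h : Set (AddMonoidAlgebra ℤ (Module.Dual ℂ h))) =
      Set.range (Super.sch.{u, v} h) ∧
    ∀ (t : LieSubalgebra ℂ (Super.part (Super.DSAlg x) 0)) [t.IsCartanSubalgebra],
      (Super.JRing.{u, v} t : Set (AddMonoidAlgebra ℤ (Module.Dual ℂ t))) =
        Set.range (Super.sch.{u, v} t) ∧
      (∃! ds : Super.JRing.{u, v} h →+* Super.JRing.{u, v} t,
        ∀ M : Super.SMod.{u, v} g, ds (Super.JRing.cls h M) = Super.JRing.cls t (M.DS x)) ∧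
      (∀ ι : t →ₗ[ℂ] h, Super.IsEmbeddingInto ι → ∀ M : Super.SMod.{u, v} g,
        Super.sch t (M.DS x) = Super.restrictExp ι (Super.sch h M)) :=
  ⟨Super.existsUnique_ds_KRing x, Super.coe_JRing h, fun t _ =>
    ⟨Super.coe_JRing t, Super.existsUnique_ds_JRing t h, Super.sch_DS_eq_restrictExp t h⟩⟩
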